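/- Let $M$ be a smooth $m$-dimensional manifold (Hausdorff, second countable, without boundary), and let $A=C^\infty(M)$ be its real algebra of smooth real-valued functions. For $k\ge 0$ put $C^k(A,A)=\mathrm{Hom}_{\mathbb R}(A^{\otimes k},A)$ and equip $C^\bullet(A,A)=\bigoplus_{k\ge 0}C^k(A,A)$ with the cup product $$(f\smile g)(a_1\otimes\cdots\otimes a_{k+l})=f(a_1\otimes\cdots\otimes a_k)\,g(a_{k+1}\otimes\cdots\otimes a_{k+l}),\qquad f\in C^k(A,A),\ g\in C^l(A,A).$$ Let $MDer(A)$ be the (not necessarily unital) subalgebra of $(C^\bullet(A,A),\smile)$ generated by the derivations $Der(A)\subset C^1(A,A)$, and let $MDer^n(A)=MDer(A)\cap C^n(A,A)$. Let $\Gamma((TM)^{\otimes n})$ be the real vector space of smooth sections of the $n$-th tensor power of the tangent bundle. For $\tau_p\in (T_pM)^{\otimes n}$ and $f_1,\dots,f_n\in A$ let $\tau_p(f_1\otimes\cdots\otimes f_n)\in\mathbb R$ be determined by linearity in $\tau_p$ and $(v_1\otimes\cdots\otimes v_n)(f_1\otimes\cdots\otimes f_n)=v_1(f_1)\cdots v_n(f_n)$,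 where $v(f)=df_p(v)$. Then for every $n\ge 1$ the assignment $\tau\mapsto\bar\tau$, $$\bar\tau(f_1\otimes\cdots\otimes f_n)(p)=\tau_p(f_1\otimes\cdots\otimes f_n),\qquad p\in M,$$ is a well-defined isomorphism of real vector spaces $$\Gamma((TM)^{\otimes n})\;\cong\;MDer^n(C^\infty(M)).$$ Moreover, let $(U,\varphi)$ be a chart of $M$ with coordinates $x^1,\dots,x^m$, and let $D\in MDer^n(C^\infty(M))$. For each $p\in U$ there are $\tilde x^1,\dots,\tilde x^m\in C^\infty(M)$ such that $\tilde x^j=x^j$ near $p$ for all $j$; the number $D(x^{j_1}\otimes\cdots\otimes x^{j_n})(p):=D(\tilde x^{j_1}\otimes\cdots\otimes\tilde x^{j_n})(p)$ does not depend on their choice, and it is a smooth function of $p\in U$. On $U$, $$D=\sum_{j_1,\dots,j_n=1}^m D(x^{j_1}\otimes\cdots\otimes x^{j_n})\,\frac{\partial}{\partial x^{j_1}}\otimes\cdots\otimes\frac{\partial}{\partial x^{j_n}},$$ that is, the right-hand side is the restriction to $U$ of the tensor field corresponding to $D$, and for all $f_1,\dots,f_n\in C^\infty(M)$ and $p\in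 U$, $$D(f_1\otimes\cdots\otimes f_n)(p)=\sum_{j_1,\dots,j_n=1}^m D(x^{j_1}\otimes\cdots\otimes x^{j_n})(p)\,\prod_{k=1}^n\frac{\partial (f_k\circ\varphi^{-1})}{\partial t^{j_k}}\Big|_{\varphi(p)} .$$ -/

import Mathlib

open scoped Manifold ContDiff TensorProduct DirectSum Topology
open Bundle

/-! ### Hochschild cochains, the cup product and multiderivations -/

section Hochschild

variable (K : Type*) [CommRing K] (A : Type*) [CommRing A] [Algebra K A]

/-- Hochschild cochains `Cⁿ(A, A) = Hom_K(A^{⊗ n}, A)`. -/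
abbrev HochschildCochain (n : ℕ) : Type _ := (⨂[K]^n A) →ₗ[K] A

variable {K A}

/-- The cup product `Cᵐ(A, A) × Cⁿ(A, A) → Cᵐ⁺ⁿ(A, A)`,
`(f ⌣ g)(a₁ ⊗ ⋯ ⊗ aₘ₊ₙ) = f(a₁ ⊗ ⋯ ⊗ aₘ) g(aₘ₊₁ ⊗ ⋯ ⊗ aₘ₊ₙ)`. -/
noncomputable def HochschildCochain.cup {m n : ℕ} (f : HochschildCochain K A m)
    (g : HochschildCochain K A n) : HochschildCochain K A (m + n) :=
  LinearMap.mul' K A ∘ₗ TensorProduct.map f g ∘ₗ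
    (TensorPower.mulEquiv (R := K) (M := A) (n := m) (m := n)).symm.toLinearMap

theorem HochschildCochain.cup_tprod {m n : ℕ} (f : HochschildCochain K A m)
    (g : HochschildCochain K A n) (a : Fin (m + n) → A) :
    f.cup g (PiTensorProduct.tprod K a) =
      f (PiTensorProduct.tprod K fun i => a (Fin.castAdd n i)) *
        g (PiTensorProduct.tprod K fun i => a (Fin.natAdd m i)) := by
  simp [HochschildCochain.cup, TensorPower.mulEquiv, PiTensorProduct.reindex_symm]

variable (K A)

/-- The cup product makes `C^•(A, A)` a graded algebra. -/
noncomputable instance HochschildCochain.instGMul :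
    DirectSum.GNonUnitalNonAssocSemiring (HochschildCochain K A) where
  mul f g := HochschildCochain.cup f g
  mul_zero f := by simp [HochschildCochain.cup]
  zero_mul f := by simp [HochschildCochain.cup]
  mul_add f g h := by
    simp [HochschildCochain.cup, TensorProduct.map_add_right, LinearMap.add_comp,
      LinearMap.comp_add]
  add_mul f g h := by
    simp [HochschildCochain.cup, TensorProduct.map_add_left, LinearMap.add_comp,
      LinearMap.comp_add]

/-- The space of all cochains `C^•(A, A) = ⨁ₙ Cⁿ(A, A)`, with the cup product as multiplication. -/
abbrev HochschildAlgebra : Type _ := ⨁ n, HochschildCochain K A n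

instance HochschildAlgebra.instIsScalarTower :
    IsScalarTower K (HochschildAlgebra K A) (HochschildAlgebra K A) where
  smul_assoc c x y := by
    classical
    induction x using DirectSum.induction_on with
    | zero => simp
    | add x₁ x₂ h₁ h₂ => simp only [smul_eq_mul] at *; rw [smul_add, add_mul, add_mul, smul_add, h₁, h₂]
    | of i f =>
      induction y using DirectSum.induction_on with
      | zero => simp
      | add y₁ y₂ h₁ h₂ => simp only [smul_eq_mul] at *; rw [mul_add, mul_add, smul_add, h₁, h₂]
      | of j g =>
        simp only [smul_eq_mul, ← DirectSum.of_smul, DirectSum.of_mul_of]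
        congr 1
        exact PiTensorProduct.ext (by
          ext a
          simp [GradedMonoid.GMul.mul, HochschildCochain.cup_tprod])

instance HochschildAlgebra.instSMulCommClass :
    SMulCommClass K (HochschildAlgebra K A) (HochschildAlgebra K A) where
  smul_comm c x y := by
    classical
    induction x using DirectSum.induction_on with
    | zero => simp
    | add x₁ x₂ h₁ h₂ => simp only [smul_eq_mul] at *; rw [add_mul, add_mul, smul_add, h₁, h₂]
    | of i f =>
      induction y using DirectSum.induction_on with
      | zero => simp
      | add y₁ y₂ h₁ h₂ =>
        simp only [smul_eq_mul] at *; rw [smul_add, mul_add, mul_add, smul_add, h₁, h₂]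
      | of j g =>
        simp only [smul_eq_mul, ← DirectSum.of_smul, DirectSum.of_mul_of]
        congr 1
        exact PiTensorProduct.ext (by
          ext a
          simp [GradedMonoid.GMul.mul, HochschildCochain.cup_tprod])

variable {K A} in
/-- A derivation of `A`, regarded as a Hochschild cochain of degree one: `X(a)` on `a ∈ A^{⊗ 1}`. -/
noncomputable def Derivation.toCochain (X : Derivation K A A) : HochschildCochain K A 1 :=
  X.toLinearMap ∘ₗ (PiTensorProduct.subsingletonEquiv (R := K) (s := fun _ => A) (0 : Fin 1)).toLinearMap

/-- The multiderivations: the (non-unital) subalgebra of `(C^•(A, A), ⌣)` generated by `Der(A)`. -/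
noncomputable def multiderivations : NonUnitalSubalgebra K (HochschildAlgebra K A) :=
  NonUnitalAlgebra.adjoin K
    (Set.range fun X : Derivation K A A => DirectSum.of (HochschildCochain K A) 1 X.toCochain)

/-- `MDerⁿ(A) = MDer(A) ∩ Cⁿ(A, A)`. -/
noncomputable def MDer (n : ℕ) : Submodule K (HochschildCochain K A n) :=
  (multiderivations K A).toSubmodule.comap (DirectSum.lof K ℕ (HochschildCochain K A) n)

end Hochschild

/-! ### The tensor bundle `(TM)^{⊗ n}` and its smooth sections -/

section TensorBundle

/-- The model fibre `(ℝᵐ)^{⊗ n}`, with the projective norm. -/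
abbrev TensorModel (m n : ℕ) : Type := ⨂[ℝ]^n (EuclideanSpace ℝ (Fin m))

theorem TensorModel.eq_zero_of_norm_eq_zero (m n : ℕ) (x : TensorModel m n) (hx : ‖x‖ = 0) :
    x = 0 := by
  let b := (EuclideanSpace.basisFun (Fin m) ℝ).toBasis
  let B := Basis.piTensorProduct (R := ℝ) (ι := Fin n) fun _ => b
  refine B.ext_elem fun J => ?_
  let f : ContinuousMultilinearMap ℝ (fun _ : Fin n => EuclideanSpace ℝ (Fin m)) ℝ :=
    (ContinuousMultilinearMap.mkPiAlgebra ℝ (Fin n) ℝ).compContinuousLinearMap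
      fun k => EuclideanSpace.proj (J k)
  have h := PiTensorProduct.norm_eval_le_projectiveSeminorm f x
  rw [hx, mul_zero] at h
  have h' : PiTensorProduct.lift f.toMultilinearMap x = 0 := norm_le_zero_iff.mp h
  have key : PiTensorProduct.lift f.toMultilinearMap = B.coord J := by
    ext v
    simp [f, B, b]
  rw [key] at h'
  simpa using h'

noncomputable instance TensorModel.instNormedAddCommGroup (m n : ℕ) :
    NormedAddCommGroup (TensorModel m n) :=
  NormedAddCommGroup.ofSeparation (TensorModel.eq_zero_of_norm_eq_zero m n)

variable {m : ℕ} {M : Type*} [TopologicalSpace M] [ChartedSpace (EuclideanSpace ℝ (Fin m)) M]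

/-- The fibre `(T_pM)^{⊗ n}` of the tensor bundle. -/
def TensorSpace (m n : ℕ) {M : Type*} [TopologicalSpace M]
    [ChartedSpace (EuclideanSpace ℝ (Fin m)) M] (p : M) : Type :=
  ⨂[ℝ]^n (TangentSpace (𝓡 m) p)

noncomputable instance (n : ℕ) (p : M) : AddCommGroup (TensorSpace m n p) :=
  inferInstanceAs (AddCommGroup (⨂[ℝ]^n (TangentSpace (𝓡 m) p)))

noncomputable instance (n : ℕ) (p : M) : Module ℝ (TensorSpace m n p) :=
  inferInstanceAs (Module ℝ (⨂[ℝ]^n (TangentSpace (𝓡 m) p)))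

/-- The `n`-th tensor power of a linear map `T_pM → ℝᵐ`. -/
noncomputable def TensorSpace.toModel (n : ℕ) {p : M}
    (L : TangentSpace (𝓡 m) p →ₗ[ℝ] EuclideanSpace ℝ (Fin m)) :
    TensorSpace m n p →ₗ[ℝ] TensorModel m n :=
  PiTensorProduct.map fun _ => L

/-- The `n`-th tensor power of a linear map `ℝᵐ → T_pM`. -/
noncomputable def TensorSpace.ofModel (n : ℕ) {p : M}
    (L : EuclideanSpace ℝ (Fin m) →ₗ[ℝ] TangentSpace (𝓡 m) p) :
    TensorModel m n →ₗ[ℝ] TensorSpace m n p :=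
  PiTensorProduct.map fun _ => L

theorem TensorSpace.ofModel_toModel (n : ℕ) {p : M}
    (L : TangentSpace (𝓡 m) p →ₗ[ℝ] EuclideanSpace ℝ (Fin m))
    (L' : EuclideanSpace ℝ (Fin m) →ₗ[ℝ] TangentSpace (𝓡 m) p) (h : ∀ v, L' (L v) = v)
    (x : TensorSpace m n p) : ofModel n L' (toModel n L x) = x := by
  have h' : L' ∘ₗ L = LinearMap.id := LinearMap.ext h
  have : PiTensorProduct.map (fun _ : Fin n => L') ∘ₗ PiTensorProduct.map (fun _ : Fin n => L) =
      LinearMap.id := by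
    rw [← PiTensorProduct.map_comp]; simp [h']
  exact LinearMap.congr_fun this x

theorem TensorSpace.toModel_ofModel (n : ℕ) {p : M}
    (L : TangentSpace (𝓡 m) p →ₗ[ℝ] EuclideanSpace ℝ (Fin m))
    (L' : EuclideanSpace ℝ (Fin m) →ₗ[ℝ] TangentSpace (𝓡 m) p)
    (T : EuclideanSpace ℝ (Fin m) →L[ℝ] EuclideanSpace ℝ (Fin m)) (h : ∀ v, L (L' v) = T v)
    (x : TensorModel m n) :
    toModel n L (ofModel n L' x) = PiTensorProduct.mapL (fun _ : Fin n => T) x := by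
  have h' : L ∘ₗ L' = T.toLinearMap := LinearMap.ext h
  have : PiTensorProduct.map (fun _ : Fin n => L) ∘ₗ PiTensorProduct.map (fun _ : Fin n => L') =
      PiTensorProduct.map (fun _ : Fin n => T.toLinearMap) := by
    rw [← PiTensorProduct.map_comp, h']
  exact LinearMap.congr_fun this x

/-- The elementary tensor `v₁ ⊗ ⋯ ⊗ vₙ ∈ (T_pM)^{⊗ n}`. -/
noncomputable def TensorSpace.tprod {n : ℕ} {p : M} (v : Fin n → TangentSpace (𝓡 m) p) :
    TensorSpace m n p :=
  PiTensorProduct.tprod ℝ v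

/-- The action of `τ ∈ (T_pM)^{⊗ n}` on functions: the linear extension in `τ` of
`(v₁ ⊗ ⋯ ⊗ vₙ)(f₁ ⊗ ⋯ ⊗ fₙ) = v₁(f₁) ⋯ vₙ(fₙ)`, where `v(f) = df_p(v)`. -/
noncomputable def TensorSpace.act {n : ℕ} {p : M} (τ : TensorSpace m n p)
    (f : Fin n → C^∞⟮𝓡 m, M; ℝ⟯) : ℝ :=
  PiTensorProduct.dualDistrib (R := ℝ) (M := fun _ : Fin n => TangentSpace (𝓡 m) p)
    (PiTensorProduct.tprod ℝ fun k => (mvfderiv (𝓡 m) (f k) p).toLinearMap) τ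

theorem TensorSpace.act_tprod {n : ℕ} {p : M} (v : Fin n → TangentSpace (𝓡 m) p)
    (f : Fin n → C^∞⟮𝓡 m, M; ℝ⟯) :
    (TensorSpace.tprod v).act f = ∏ k, mvfderiv (𝓡 m) (f k) p (v k) :=
  PiTensorProduct.dualDistrib_apply _ _

/-- The coordinate vector `∂/∂xʲ|_p = d(φ⁻¹)_{φ(p)}(∂/∂tʲ)` of a chart `φ` around `p`. -/
noncomputable def coordVector (φ : OpenPartialHomeomorph M (EuclideanSpace ℝ (Fin m))) (p : M)
    (j : Fin m) : TangentSpace (𝓡 m) p :=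
  mfderiv (𝓡 m) (𝓡 m) φ.symm (φ p) (EuclideanSpace.single j (1 : ℝ))

variable [IsManifold (𝓡 m) ∞ M]

/-- The trivialization of `(TM)^{⊗ n}` induced by a trivialization `e` of `TM`: on the fibre over
`p` it is the `n`-th tensor power of the linear map `e_p : T_pM → ℝᵐ`. -/
noncomputable def TensorSpace.pretrivialization (n : ℕ)
    (e : Trivialization (EuclideanSpace ℝ (Fin m))
      (π (EuclideanSpace ℝ (Fin m)) (TangentSpace (𝓡 m) : M → Type))) [MemTrivializationAtlas e] :
    Pretrivialization (TensorModel m n) (π (TensorModel m n) (TensorSpace m n : M → Type)) where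
  toFun z := (z.1, TensorSpace.toModel n (e.linearMapAt ℝ z.1) z.2)
  invFun z := ⟨z.1, TensorSpace.ofModel n (e.symmₗ ℝ z.1) z.2⟩
  source := TotalSpace.proj ⁻¹' e.baseSet
  target := e.baseSet ×ˢ Set.univ
  map_source' := fun ⟨_, _⟩ h => ⟨h, Set.mem_univ _⟩
  map_target' := fun ⟨_, _⟩ h => h.1
  left_inv' := by
    rintro ⟨p, x⟩ h
    simp only [TotalSpace.mk_inj]
    exact TensorSpace.ofModel_toModel n _ _ (fun v => e.symmₗ_linearMapAt h v) x
  right_inv' := by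
    rintro ⟨p, x⟩ ⟨h, -⟩
    simp only [Prod.mk_right_inj]
    rw [TensorSpace.toModel_ofModel n _ _ (ContinuousLinearMap.id ℝ _)
      (fun v => e.linearMapAt_symmₗ h v), PiTensorProduct.mapL_id]
    rfl
  open_target := e.open_baseSet.prod isOpen_univ
  baseSet := e.baseSet
  open_baseSet := e.open_baseSet
  source_eq := rfl
  target_eq := rfl
  proj_toFun _ _ := rfl

noncomputable instance (n : ℕ) (p : M) : TopologicalSpace (TensorSpace m n p) :=
  TopologicalSpace.induced (TensorSpace.toModel n
    ((trivializationAt (EuclideanSpace ℝ (Fin m)) (TangentSpace (𝓡 m) : M → Type) p).linearMapAt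
      ℝ p)) inferInstance

/-- The vector bundle structure of `(TM)^{⊗ n}`, given by the trivializations induced by those
of `TM`. -/
noncomputable def TensorSpace.vectorPrebundle (m n : ℕ) (M : Type*) [TopologicalSpace M]
    [ChartedSpace (EuclideanSpace ℝ (Fin m)) M] [IsManifold (𝓡 m) ∞ M] :
    VectorPrebundle ℝ (TensorModel m n) (TensorSpace m n : M → Type) where
  pretrivializationAtlas := {e' | ∃ (e : Trivialization (EuclideanSpace ℝ (Fin m))
      (π (EuclideanSpace ℝ (Fin m)) (TangentSpace (𝓡 m) : M → Type)))
      (_ : MemTrivializationAtlas e), e' = TensorSpace.pretrivialization n e}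
  pretrivialization_linear' := by
    rintro _ ⟨e, he, rfl⟩
    exact ⟨fun p _ => (TensorSpace.toModel n (e.linearMapAt ℝ p)).isLinear⟩
  pretrivializationAt p := TensorSpace.pretrivialization n
    (trivializationAt (EuclideanSpace ℝ (Fin m)) (TangentSpace (𝓡 m) : M → Type) p)
  mem_base_pretrivializationAt p := mem_baseSet_trivializationAt _ _ p
  pretrivialization_mem_atlas p := ⟨_, inferInstance, rfl⟩
  exists_coordChange := by
    rintro _ ⟨e, he, rfl⟩ _ ⟨e', he', rfl⟩
    refine ⟨fun p => PiTensorProduct.mapL fun _ : Fin n =>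
      (e.coordChangeL ℝ e' p : EuclideanSpace ℝ (Fin m) →L[ℝ] EuclideanSpace ℝ (Fin m)), ?_, ?_⟩
    · exact (PiTensorProduct.mapLMultilinear ℝ (fun _ : Fin n => EuclideanSpace ℝ (Fin m))
        (fun _ : Fin n => EuclideanSpace ℝ (Fin m))).cont.comp_continuousOn
          (continuousOn_pi.2 fun _ => continuousOn_coordChange ℝ e e')
    · intro p hp x
      rw [Pretrivialization.symm_apply _ hp.1]
      refine (TensorSpace.toModel_ofModel n _ _ _ (fun v => ?_) x).symm
      rw [Trivialization.coe_linearMapAt_of_mem _ hp.2, Trivialization.symmₗ_apply]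
      · exact (e.coordChangeL_apply e' hp v).symm
      · exact hp.1
  totalSpaceMk_isInducing _ := Topology.isInducing_const_prod.2 ⟨rfl⟩

noncomputable instance (n : ℕ) :
    TopologicalSpace (TotalSpace (TensorModel m n) (TensorSpace m n : M → Type)) :=
  (TensorSpace.vectorPrebundle m n M).totalSpaceTopology

noncomputable instance (n : ℕ) : FiberBundle (TensorModel m n) (TensorSpace m n : M → Type) :=
  (TensorSpace.vectorPrebundle m n M).toFiberBundle

instance (n : ℕ) : VectorBundle ℝ (TensorModel m n) (TensorSpace m n : M → Type) :=
  (TensorSpace.vectorPrebundle m n M).toVectorBundle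

/-- The tensor bundle is a smooth vector bundle: its coordinate changes are smooth. -/
instance (n : ℕ) : (TensorSpace.vectorPrebundle m n M).IsContMDiff (𝓡 m) ∞ where
  exists_contMDiffCoordChange := by
    rintro _ ⟨e, he, rfl⟩ _ ⟨e', he', rfl⟩
    refine ⟨fun p => PiTensorProduct.mapL fun _ : Fin n =>
      (e.coordChangeL ℝ e' p : EuclideanSpace ℝ (Fin m) →L[ℝ] EuclideanSpace ℝ (Fin m)), ?_, ?_⟩
    · exact (PiTensorProduct.mapLMultilinear ℝ (fun _ : Fin n => EuclideanSpace ℝ (Fin m))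
        (fun _ : Fin n => EuclideanSpace ℝ (Fin m))).contDiff.contMDiff.comp_contMDiffOn
          (contMDiffOn_pi_space.2 fun _ => contMDiffOn_coordChangeL e e')
    · intro p hp x
      rw [Pretrivialization.symm_apply _ hp.1]
      refine (TensorSpace.toModel_ofModel n _ _ _ (fun v => ?_) x).symm
      rw [Trivialization.coe_linearMapAt_of_mem _ hp.2, Trivialization.symmₗ_apply]
      · exact (e.coordChangeL_apply e' hp v).symm
      · exact hp.1

instance (n : ℕ) :
    ContMDiffVectorBundle ∞ (TensorModel m n) (TensorSpace m n : M → Type) (𝓡 m) :=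
  VectorPrebundle.contMDiffVectorBundle (𝓡 m) (TensorSpace.vectorPrebundle m n M)

/-- `Γ((TM)^{⊗ n})`, the real vector space of smooth sections of the tensor bundle. -/
abbrev TensorField (m n : ℕ) (M : Type*) [TopologicalSpace M]
    [ChartedSpace (EuclideanSpace ℝ (Fin m)) M] [IsManifold (𝓡 m) ∞ M] : Type _ :=
  ContMDiffSection (𝓡 m) (TensorModel m n) ∞ (TensorSpace m n : M → Type)

end TensorBundle

/-! Multiderivations of degree `n` are linear combinations of products `X₁ ⊗ ⋯ ⊗ Xₙ` of derivations,
because the cup product of two such products is again one (`MDer_le_span`). By cut-off functions and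
Hadamard's lemma, `X f p` depends on `f` only through `df_p`. Hence `D(f₁ ⊗ ⋯ ⊗ fₙ)(p)` is
multilinear in the covectors `df_k` at `p`. Expanding these in a chart gives the coordinate formula
and a tensor at `p` (`MDer.exists_tensorField`). The tensors vary smoothly because smoothness of a
section can be tested on functions (`contMDiff_section_iff_act`).

The converse is the harder half: a global tensor field must be a finite sum of products of global
derivations, although `M` may be noncompact. It suffices to find finitely many functions `h_i` whose
differentials span every cotangent space (`exists_separatesTangentOn_univ`). Over a compact set, the
dimension count of Whitney's immersion theorem brings their number down to `2m + 1`, whatever the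
set. An exhaustion of `M` by compact sets is then handled with three families, the shells being
sorted by their index mod 3. The gradients `Y_i` of the `h_i` for the metric `∑ dh_j ⊗ dh_j` satisfy
`df = ∑ Y_i(f) dh_i`, so `τ = ∑ τ(h_I) Y_{i₁} ⊗ ⋯ ⊗ Y_{iₙ}`. The coefficient `τ(h_I)` is absorbed
into the first derivation, which is where `n ≥ 1` enters. -/

/-! ### Cut-off functions, differentials and tensors in a chart. -/

section ChartCalculus

variable {m : ℕ} {M : Type*} [TopologicalSpace M] [ChartedSpace (EuclideanSpace ℝ (Fin m)) M]

/-- A function that is smooth near `p` agrees near `p` with a global smooth function supported in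
a prescribed neighbourhood. -/
theorem exists_contMDiffMap_eventuallyEq [IsManifold (𝓡 m) ∞ M] [T2Space M] {g : M → ℝ} {p : M}
    {U : Set M} (hU : IsOpen U) (hp : p ∈ U) (hg : ContMDiffOn (𝓡 m) 𝓘(ℝ, ℝ) ∞ g U) :
    ∃ f : C^∞⟮𝓡 m, M; ℝ⟯, (f : M → ℝ) =ᶠ[𝓝 p] g ∧ ∀ q ∉ U, f q = 0 := by
  obtain ⟨b, -, hbU⟩ := ((SmoothBumpFunction.nhds_basis_tsupport (I := 𝓡 m) p).mem_iff).1
    (hU.mem_nhds hp)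
  refine ⟨⟨fun x => b x • g x, contMDiff_of_tsupport fun x hx => ?_⟩, ?_, ?_⟩
  · have hx' : x ∈ U := hbU (tsupport_smul_subset_left b g hx)
    exact b.contMDiffAt.smul (hg.contMDiffAt (hU.mem_nhds hx'))
  · filter_upwards [b.eventuallyEq_one] with x hx
    simp [hx]
  · intro q hq
    have : b q = 0 := image_eq_zero_of_notMem_tsupport fun h => hq (hbU h)
    simp [this]

theorem mvfderiv_congr {f g : M → ℝ} {p : M} (h : f =ᶠ[𝓝 p] g) :
    mvfderiv (𝓡 m) f p = mvfderiv (𝓡 m) g p := by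
  ext v
  simp only [mvfderiv, h.mfderiv_eq, ContinuousLinearMap.comp_apply]
  rfl

theorem ContMDiffMap.sum_eval {ι : Type*} (s : Finset ι) (f : ι → C^∞⟮𝓡 m, M; ℝ⟯) (p : M) :
    (∑ i ∈ s, f i : C^∞⟮𝓡 m, M; ℝ⟯) p = ∑ i ∈ s, f i p := by
  classical
  induction s using Finset.induction_on with
  | empty => simp
  | insert i s hi ih => rw [Finset.sum_insert hi, Finset.sum_insert hi, ← ih]; rfl

theorem ContMDiffMap.mdifferentiableAt_top (f : C^∞⟮𝓡 m, M; ℝ⟯) (p : M) :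
    MDifferentiableAt (𝓡 m) 𝓘(ℝ, ℝ) f p :=
  f.contMDiff.mdifferentiableAt (by simp)

theorem contMDiffAt_iff_repr {E : Type*} [NormedAddCommGroup E] [NormedSpace ℝ E]
    [FiniteDimensional ℝ E] {ι : Type*} [Fintype ι] (b : Module.Basis ι ℝ E) {s : M → E} {p : M} :
    ContMDiffAt (𝓡 m) 𝓘(ℝ, E) ∞ s p ↔
      ∀ i, ContMDiffAt (𝓡 m) 𝓘(ℝ, ℝ) ∞ (fun q => b.repr (s q) i) p := by
  constructor
  · intro h i
    exact ((LinearMap.toContinuousLinearMap (b.coord i)).contDiff.contMDiff.contMDiffAt).comp p h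
  · intro h
    have : s = fun q => ∑ i, b.repr (s q) i • b i := funext fun q => (b.sum_repr _).symm
    rw [this]
    exact ContMDiffAt.sum fun i _ => (h i).smul contMDiffAt_const

/-- The differential at `p`, as a linear map on smooth functions. -/
noncomputable def ContMDiffMap.differential (p : M) :
    C^∞⟮𝓡 m, M; ℝ⟯ →ₗ[ℝ] (TangentSpace (𝓡 m) p →L[ℝ] ℝ) where
  toFun f := mvfderiv (𝓡 m) f p
  map_add' f g := mvfderiv_add (f.mdifferentiableAt_top p) (g.mdifferentiableAt_top p)
  map_smul' c f := by
    -- Homogeneity is the Leibniz rule with a constant factor.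
    have h := mvfderiv_mul (I := 𝓡 m) (f := fun _ : M => c) (g := f)
      mdifferentiableAt_const (f.mdifferentiableAt_top p)
    rw [mvfderiv_const, smul_zero, add_zero] at h
    exact h

theorem ContMDiffMap.differential_apply (f : C^∞⟮𝓡 m, M; ℝ⟯) (p : M) :
    differential p f = mvfderiv (𝓡 m) f p := rfl

variable {φ : OpenPartialHomeomorph M (EuclideanSpace ℝ (Fin m))}

theorem mdifferentiable_of_mem_maximalAtlas (hφ : φ ∈ IsManifold.maximalAtlas (𝓡 m) ∞ M) :
    φ.MDifferentiable (𝓡 m) (𝓡 m) :=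
  ⟨(contMDiffOn_of_mem_maximalAtlas hφ).mdifferentiableOn (by simp),
    (contMDiffOn_symm_of_mem_maximalAtlas hφ).mdifferentiableOn (by simp)⟩

theorem contDiffAt_comp_chart_symm (hφ : φ ∈ IsManifold.maximalAtlas (𝓡 m) ∞ M) {x}
    (hx : x ∈ φ.target) {f : M → ℝ} (hf : ContMDiffAt (𝓡 m) 𝓘(ℝ, ℝ) ∞ f (φ.symm x)) :
    ContDiffAt ℝ ∞ (f ∘ φ.symm) x :=
  (hf.comp x (contMDiffAt_symm_of_mem_maximalAtlas hφ hx)).contDiffAt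

theorem contMDiffAt_comp_chart (hφ : φ ∈ IsManifold.maximalAtlas (𝓡 m) ∞ M) {p}
    (hp : p ∈ φ.source) {F : Type*} [NormedAddCommGroup F] [NormedSpace ℝ F]
    {u : EuclideanSpace ℝ (Fin m) → F} (hu : ContDiffAt ℝ ∞ u (φ p)) :
    ContMDiffAt (𝓡 m) 𝓘(ℝ, F) ∞ (u ∘ φ) p :=
  hu.contMDiffAt.comp p (contMDiffAt_of_mem_maximalAtlas hφ hp)

theorem mvfderiv_mfderiv_chart_symm (hφ : φ ∈ IsManifold.maximalAtlas (𝓡 m) ∞ M) {p : M}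
    (hp : p ∈ φ.source) (f : C^∞⟮𝓡 m, M; ℝ⟯) (v : EuclideanSpace ℝ (Fin m)) :
    mvfderiv (𝓡 m) f p (mfderiv (𝓡 m) (𝓡 m) φ.symm (φ p) v) =
      fderiv ℝ (f ∘ φ.symm) (φ p) v := by
  have h := mfderiv_comp_of_eq (I := 𝓡 m) (I' := 𝓡 m) (I'' := 𝓘(ℝ, ℝ)) (x := φ p) (y := p)
    (g := f) (f := φ.symm) (f.mdifferentiableAt_top p)
    ((mdifferentiable_of_mem_maximalAtlas hφ).mdifferentiableAt_symm (φ.map_source hp))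
    (φ.left_inv hp)
  rw [mfderiv_eq_fderiv] at h
  rw [h]
  change mfderiv (𝓡 m) 𝓘(ℝ, ℝ) f p (mfderiv (𝓡 m) (𝓡 m) φ.symm (φ p) v) =
    mfderiv (𝓡 m) 𝓘(ℝ, ℝ) f (φ.symm (φ p)) (mfderiv (𝓡 m) (𝓡 m) φ.symm (φ p) v)
  -- The two base points `p` and `φ.symm (φ p)` are equal only propositionally.
  have e := φ.left_inv hp
  rw [e]

theorem mvfderiv_coordVector (hφ : φ ∈ IsManifold.maximalAtlas (𝓡 m) ∞ M) {p : M}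
    (hp : p ∈ φ.source) (f : C^∞⟮𝓡 m, M; ℝ⟯) (j : Fin m) :
    mvfderiv (𝓡 m) f p (coordVector φ p j) =
      fderiv ℝ (f ∘ φ.symm) (φ p) (EuclideanSpace.single j 1) :=
  mvfderiv_mfderiv_chart_symm hφ hp f _

/-- `x` are global smooth functions which agree near `p` with the coordinates of the chart `φ`. -/
def IsCoordGerm (φ : OpenPartialHomeomorph M (EuclideanSpace ℝ (Fin m))) (p : M)
    (x : Fin m → C^∞⟮𝓡 m, M; ℝ⟯) : Prop :=
  ∀ j, (x j : M → ℝ) =ᶠ[𝓝 p] fun q => φ q j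

theorem exists_isCoordGerm [IsManifold (𝓡 m) ∞ M] [T2Space M] (hφ : φ ∈ IsManifold.maximalAtlas (𝓡 m) ∞ M) {p : M}
    (hp : p ∈ φ.source) : ∃ x, IsCoordGerm φ p x := by
  have (j : Fin m) := exists_contMDiffMap_eventuallyEq (g := fun q => φ q j) φ.open_source hp
    fun q hq => ((contMDiffAt_comp_chart hφ hq (u := fun y => y j)
      (by fun_prop)).contMDiffWithinAt)
  choose x hx _ using this
  exact ⟨x, hx⟩

variable {p : M} {x : Fin m → C^∞⟮𝓡 m, M; ℝ⟯}

/-- Lets one fixed family `x` serve at all points near `p`, so that smoothness at `p` can be checked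
with it. -/
theorem IsCoordGerm.eventually (hx : IsCoordGerm φ p x) : ∀ᶠ q in 𝓝 p, IsCoordGerm φ q x :=
  Filter.eventually_all.2 fun j => (hx j).eventually_nhds

theorem IsCoordGerm.comp_symm (hx : IsCoordGerm φ p x) (hp : p ∈ φ.source) (j : Fin m) :
    x j ∘ φ.symm =ᶠ[𝓝 (φ p)] fun y => y j := by
  have h : Filter.Tendsto φ.symm (𝓝 (φ p)) (𝓝 p) := φ.tendsto_symm hp
  filter_upwards [h.eventually (hx j), φ.open_target.mem_nhds (φ.map_source hp)] with y hy hy'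
  simp [hy, φ.right_inv hy']

theorem IsCoordGerm.fderiv_apply (hx : IsCoordGerm φ p x) (hp : p ∈ φ.source) (j : Fin m)
    (v : EuclideanSpace ℝ (Fin m)) : fderiv ℝ (x j ∘ φ.symm) (φ p) v = v j := by
  rw [(hx.comp_symm hp j).fderiv_eq]
  exact DFunLike.congr_fun 
    ((EuclideanSpace.proj j : EuclideanSpace ℝ (Fin m) →L[ℝ] ℝ).fderiv (x := φ p)) v

/-- With `w = dφ(v)`, the components of `w` are the numbers `dx_j(v)`, and `dφ⁻¹` carries the
expansion of `w` in the standard basis back to `v`. -/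
theorem IsCoordGerm.sum_smul_coordVector (hφ : φ ∈ IsManifold.maximalAtlas (𝓡 m) ∞ M)
    (hx : IsCoordGerm φ p x) (hp : p ∈ φ.source) (v : TangentSpace (𝓡 m) p) :
    v = ∑ j, mvfderiv (𝓡 m) (x j) p v • coordVector φ p j := by
  have hd := mdifferentiable_of_mem_maximalAtlas hφ
  have hv : mfderiv (𝓡 m) (𝓡 m) φ.symm (φ p) (mfderiv (𝓡 m) (𝓡 m) φ p v) = v :=
    DFunLike.congr_fun (hd.symm_comp_deriv hp) v
  set w : EuclideanSpace ℝ (Fin m) := mfderiv (𝓡 m) (𝓡 m) φ p v with hw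
  have hc (j) : mvfderiv (𝓡 m) (x j) p v = w j := by
    rw [← hx.fderiv_apply hp j w, ← mvfderiv_mfderiv_chart_symm hφ hp (x j) w, hv]
  have hws : w = ∑ j, w j • EuclideanSpace.single j (1 : ℝ) := by
    ext i; simp [Finset.sum_apply, Pi.single_apply]
  simp only [hc, coordVector]
  refine hv.symm.trans ((congrArg (mfderiv (𝓡 m) (𝓡 m) φ.symm (φ p)) hws).trans ?_)
  refine (map_sum (mfderiv (𝓡 m) (𝓡 m) φ.symm (φ p)).toLinearMap _ _).trans ?_
  exact Finset.sum_congr rfl fun j _ => (mfderiv (𝓡 m) (𝓡 m) φ.symm (φ p)).map_smul _ _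

theorem IsCoordGerm.mvfderiv_eq (hφ : φ ∈ IsManifold.maximalAtlas (𝓡 m) ∞ M)
    (hx : IsCoordGerm φ p x) (hp : p ∈ φ.source) (f : C^∞⟮𝓡 m, M; ℝ⟯) :
    mvfderiv (𝓡 m) f p = ∑ j, fderiv ℝ (f ∘ φ.symm) (φ p) (EuclideanSpace.single j 1) •
      mvfderiv (𝓡 m) (x j) p := by
  ext v
  conv_lhs => rw [hx.sum_smul_coordVector hφ hp v]
  simp [mvfderiv_coordVector hφ hp, mul_comm]

/-- The action of tensors at `p` on fixed functions, as a linear map. -/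
noncomputable def TensorSpace.actₗ {n : ℕ} (p : M) (f : Fin n → C^∞⟮𝓡 m, M; ℝ⟯) :
    TensorSpace m n p →ₗ[ℝ] ℝ :=
  PiTensorProduct.dualDistrib (R := ℝ) (M := fun _ : Fin n => TangentSpace (𝓡 m) p)
    (PiTensorProduct.tprod ℝ fun k => (mvfderiv (𝓡 m) (f k) p).toLinearMap)

theorem TensorSpace.actₗ_apply {n : ℕ} (f : Fin n → C^∞⟮𝓡 m, M; ℝ⟯) (t : TensorSpace m n p) :
    actₗ p f t = t.act f := rfl

/-- The elementary tensors at `p` depend multilinearly on their factors. -/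
noncomputable def TensorSpace.tprodₗ (n : ℕ) (p : M) :
    MultilinearMap ℝ (fun _ : Fin n => TangentSpace (𝓡 m) p) (TensorSpace m n p) :=
  PiTensorProduct.tprod ℝ

theorem TensorSpace.tprodₗ_apply {n : ℕ} (v : Fin n → TangentSpace (𝓡 m) p) :
    tprodₗ n p v = tprod v := rfl

theorem TensorSpace.induction_on {n : ℕ} {C : TensorSpace m n p → Prop}
    (smul_tprod : ∀ (r : ℝ) v, C (r • tprod v)) (add : ∀ t s, C t → C s → C (t + s))
    (t : TensorSpace m n p) : C t :=
  PiTensorProduct.induction_on t smul_tprod add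

theorem TensorSpace.hom_ext {n : ℕ} {F : Type*} [AddCommGroup F] [Module ℝ F]
    {f g : TensorSpace m n p →ₗ[ℝ] F} (h : ∀ v, f (tprod v) = g (tprod v)) : f = g := by
  ext t
  induction t using TensorSpace.induction_on with
  | smul_tprod r v => rw [map_smul, map_smul, h]
  | add t s ht hs => rw [map_add, map_add, ht, hs]

/-- A tensor at `p` in coordinates. -/
theorem IsCoordGerm.sum_act_smul_tprod (hφ : φ ∈ IsManifold.maximalAtlas (𝓡 m) ∞ M)
    (hx : IsCoordGerm φ p x) (hp : p ∈ φ.source) {n : ℕ} (t : TensorSpace m n p) :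
    t = ∑ J : Fin n → Fin m, t.act (fun k => x (J k)) •
      TensorSpace.tprod (fun k => coordVector φ p (J k)) := by
  have key : LinearMap.id = ∑ J : Fin n → Fin m, (TensorSpace.actₗ p fun k => x (J k)).smulRight
      (TensorSpace.tprod fun k => coordVector φ p (J k)) := by
    refine TensorSpace.hom_ext fun v => ?_
    simp only [LinearMap.id_apply, LinearMap.sum_apply, LinearMap.smulRight_apply,
      TensorSpace.actₗ_apply, TensorSpace.act_tprod]
    rw [← TensorSpace.tprodₗ_apply, funext fun k => hx.sum_smul_coordVector hφ hp (v k),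
      MultilinearMap.map_sum]
    -- The expansion of `v` also reached the coefficients on the right; there it is undone.
    simp only [← hx.sum_smul_coordVector hφ hp (v _)]
    exact Finset.sum_congr rfl fun J _ => MultilinearMap.map_smul_univ _ _ _
  simpa [TensorSpace.actₗ_apply] using LinearMap.congr_fun key t

/-- If covectors `df_k` are combinations of covectors `dh_i`, then the action of a tensor on
`f` is the corresponding combination of its actions on the `h_I`. -/
theorem TensorSpace.act_eq_sum {ι : Type*} [Fintype ι] [DecidableEq ι] {n : ℕ}
    (t : TensorSpace m n p) (h : ι → C^∞⟮𝓡 m, M; ℝ⟯) (f : Fin n → C^∞⟮𝓡 m, M; ℝ⟯)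
    (c : Fin n → ι → ℝ)
    (hf : ∀ k, mvfderiv (𝓡 m) (f k) p = ∑ i, c k i • mvfderiv (𝓡 m) (h i) p) :
    t.act f = ∑ I : Fin n → ι, t.act (fun k => h (I k)) * ∏ k, c k (I k) := by
  have key : actₗ p f = ∑ I : Fin n → ι, (∏ k, c k (I k)) • actₗ p fun k => h (I k) := by
    refine hom_ext fun v => ?_
    simp only [LinearMap.sum_apply, LinearMap.smul_apply, actₗ_apply, act_tprod, hf,
      sum_apply, smul_apply, smul_eq_mul,
      ← Finset.prod_mul_distrib]
    rw [Finset.prod_univ_sum]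
    simp
  simpa [actₗ_apply, mul_comm] using LinearMap.congr_fun key t

/-- The coefficients `∂ f / ∂ xʲ` are smooth. -/
theorem contMDiffAt_fderiv_comp_symm {φ : OpenPartialHomeomorph M (EuclideanSpace ℝ (Fin m))}
    (hφ : φ ∈ IsManifold.maximalAtlas (𝓡 m) ∞ M) {p : M} (hp : p ∈ φ.source)
    (f : C^∞⟮𝓡 m, M; ℝ⟯) :
    ContMDiffAt (𝓡 m) 𝓘(ℝ, EuclideanSpace ℝ (Fin m) →L[ℝ] ℝ) ∞
      (fun q => fderiv ℝ (f ∘ φ.symm) (φ q)) p :=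
  contMDiffAt_comp_chart hφ hp (u := fderiv ℝ (f ∘ φ.symm))
    ((contDiffAt_comp_chart_symm hφ (φ.map_source hp) f.contMDiff.contMDiffAt).fderiv_right
      (by simp))

end ChartCalculus

/-! ### Smoothness of sections of the tensor bundle. -/

section TensorSections

variable {m n : ℕ} {M : Type*} [TopologicalSpace M] [ChartedSpace (EuclideanSpace ℝ (Fin m)) M]
  [IsManifold (𝓡 m) ∞ M]

theorem TensorSpace.trivializationAt_apply (p₀ : M) {p : M} (t : TensorSpace m n p) :
    (trivializationAt (TensorModel m n) (TensorSpace m n : M → Type) p₀ ⟨p, t⟩).2 =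
      TensorSpace.toModel n ((trivializationAt (EuclideanSpace ℝ (Fin m))
        (TangentSpace (𝓡 m) : M → Type) p₀).linearMapAt ℝ p) t :=
  rfl

/-- The basis of `(ℝᵐ)^{⊗ n}` of tensor products of standard basis vectors. -/
noncomputable def TensorModel.basis (m n : ℕ) :
    Module.Basis (Fin n → Fin m) ℝ (TensorModel m n) :=
  Basis.piTensorProduct fun _ => (EuclideanSpace.basisFun (Fin m) ℝ).toBasis

/-- The trivialization of `TM` at `p₀` is the differential of the chart, with components `dx_j`; on
elementary tensors both sides are therefore `∏ dx_{J k}(v_k)`. -/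
theorem IsCoordGerm.coord_toModel {p₀ p : M} (hp : p ∈ (chartAt (EuclideanSpace ℝ (Fin m)) p₀).source)
    {x : Fin m → C^∞⟮𝓡 m, M; ℝ⟯} (hx : IsCoordGerm (chartAt (EuclideanSpace ℝ (Fin m)) p₀) p x)
    (t : TensorSpace m n p) (J : Fin n → Fin m) :
    (TensorModel.basis m n).repr (TensorSpace.toModel n ((trivializationAt (EuclideanSpace ℝ (Fin m))
        (TangentSpace (𝓡 m) : M → Type) p₀).linearMapAt ℝ p) t) J = t.act fun k => x (J k) := by
  set e := trivializationAt (EuclideanSpace ℝ (Fin m)) (TangentSpace (𝓡 m) : M → Type) p₀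
  have he (v : TangentSpace (𝓡 m) p) (j : Fin m) :
      (e.linearMapAt ℝ p v) j = mvfderiv (𝓡 m) (x j) p v := by
    have h1 : e.linearMapAt ℝ p v = mfderiv (𝓡 m) 𝓘(ℝ, EuclideanSpace ℝ (Fin m))
        (extChartAt (𝓡 m) p₀) p v :=
      DFunLike.congr_fun (TangentBundle.continuousLinearMapAt_trivializationAt hp) v
    have h2 := (EuclideanSpace.proj j : EuclideanSpace ℝ (Fin m) →L[ℝ] ℝ).hasMFDerivAt.comp p
      (mdifferentiableAt_extChartAt (I := 𝓡 m) hp).hasMFDerivAt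
    rw [h1, mvfderiv_congr (hx j)]
    exact (DFunLike.congr_fun h2.mfderiv v).symm
  have key : (TensorModel.basis m n).coord J ∘ₗ TensorSpace.toModel n (e.linearMapAt ℝ p) =
      TensorSpace.actₗ p fun k => x (J k) := by
    refine TensorSpace.hom_ext fun v => ?_
    rw [TensorSpace.actₗ_apply, TensorSpace.act_tprod, LinearMap.comp_apply]
    have : TensorSpace.toModel n (e.linearMapAt ℝ p) (TensorSpace.tprod v) =
      PiTensorProduct.tprod ℝ fun k => e.linearMapAt ℝ p (v k) := PiTensorProduct.map_tprod _ _
    rw [this]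
    simp [TensorModel.basis, he]
  exact LinearMap.congr_fun key t

/-- A section of `(TM)^{⊗ n}` is smooth at a point if and only if its action on coordinate
functions is. -/
theorem IsCoordGerm.contMDiffAt_iff {p : M}
    {x : Fin m → C^∞⟮𝓡 m, M; ℝ⟯} (hx : IsCoordGerm (chartAt (EuclideanSpace ℝ (Fin m)) p) p x)
    (τ : ∀ q : M, TensorSpace m n q) :
    ContMDiffAt (𝓡 m) ((𝓡 m).prod 𝓘(ℝ, TensorModel m n)) ∞
        (fun q => TotalSpace.mk' (TensorModel m n) q (τ q)) p ↔
      ∀ J : Fin n → Fin m,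
        ContMDiffAt (𝓡 m) 𝓘(ℝ, ℝ) ∞ (fun q => (τ q).act fun k => x (J k)) p := by
  rw [contMDiffAt_section, contMDiffAt_iff_repr (TensorModel.basis m n)]
  refine forall_congr' fun J => Filter.EventuallyEq.contMDiffAt_iff ?_
  filter_upwards [hx.eventually, (chartAt (EuclideanSpace ℝ (Fin m)) p).open_source.mem_nhds
    (mem_chart_source _ p)] with q hq hqs
  rw [TensorSpace.trivializationAt_apply, hq.coord_toModel hqs]

/-- Replaces bundle smoothness by smoothness of scalar functions. The components of `τ` in a chart
are its values on coordinate functions extended to `M`; conversely its value on any `f` is a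
combination of these with products of partial derivatives as coefficients. -/
theorem contMDiff_section_iff_act [T2Space M] (τ : ∀ q : M, TensorSpace m n q) :
    ContMDiff (𝓡 m) ((𝓡 m).prod 𝓘(ℝ, TensorModel m n)) ∞
        (fun q => TotalSpace.mk' (TensorModel m n) q (τ q)) ↔
      ∀ f : Fin n → C^∞⟮𝓡 m, M; ℝ⟯, ContMDiff (𝓡 m) 𝓘(ℝ, ℝ) ∞ fun q => (τ q).act f := by
  constructor
  · intro h f p
    have hφ := IsManifold.chart_mem_maximalAtlas (I := 𝓡 m) (n := ∞) p
    have hp := mem_chart_source (EuclideanSpace ℝ (Fin m)) p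
    obtain ⟨x, hx⟩ := exists_isCoordGerm hφ hp
    have h1 := (hx.contMDiffAt_iff τ).1 (h p)
    set φ := chartAt (EuclideanSpace ℝ (Fin m)) p
    have h2 : (fun q => (τ q).act f) =ᶠ[𝓝 p] fun q => ∑ J : Fin n → Fin m,
        (τ q).act (fun k => x (J k)) *
          ∏ k, fderiv ℝ (f k ∘ φ.symm) (φ q) (EuclideanSpace.single (J k) 1) := by
      filter_upwards [hx.eventually, φ.open_source.mem_nhds hp] with q hq hqs
      exact TensorSpace.act_eq_sum _ _ _ _ fun k => hq.mvfderiv_eq hφ hqs (f k)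
    refine ContMDiffAt.congr_of_eventuallyEq ?_ h2
    refine ContMDiffAt.sum fun J _ => (h1 J).mul ?_
    refine ContMDiffAt.prod fun k _ => ?_
    exact (contMDiffAt_fderiv_comp_symm hφ hp (f k)).clm_apply contMDiffAt_const
  · intro h p
    obtain ⟨x, hx⟩ := exists_isCoordGerm (IsManifold.chart_mem_maximalAtlas (I := 𝓡 m) (n := ∞) p)
      (mem_chart_source (EuclideanSpace ℝ (Fin m)) p)
    exact (hx.contMDiffAt_iff τ).2 fun J => (h _).contMDiffAt

end TensorSections

/-! ### Parameter integrals and Hadamard's lemma. -/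

section Hadamard

open MeasureTheory Set

/-- Differentiation under the integral sign; the dominating constant is a bound of the derivative on
the compact product of the unit ball around `x₀` and the interval. -/
theorem hasFDerivAt_intervalIntegral_of_contDiff {E G : Type} [NormedAddCommGroup E]
    [NormedSpace ℝ E] [FiniteDimensional ℝ E] [NormedAddCommGroup G] [NormedSpace ℝ G]
    {F : E × ℝ → G} (hF : ContDiff ℝ 1 F) (a b : ℝ) (x₀ : E) :
    HasFDerivAt (fun x => ∫ t in a..b, F (x, t))
      (∫ t in a..b, (fderiv ℝ F (x₀, t)).comp (ContinuousLinearMap.inl ℝ E ℝ)) x₀ := by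
  have hF' : Continuous fun z : E × ℝ => (fderiv ℝ F z).comp (ContinuousLinearMap.inl ℝ E ℝ) :=
    (hF.continuous_fderiv one_ne_zero).clm_comp continuous_const
  obtain ⟨C, hC⟩ := ((isCompact_closedBall x₀ 1).prod (isCompact_uIcc (a := a) (b := b))).exists_bound_of_continuousOn
    hF'.continuousOn
  refine intervalIntegral.hasFDerivAt_integral_of_dominated_of_fderiv_le
    (F := fun x t => F (x, t))
    (F' := fun x t => (fderiv ℝ F (x, t)).comp (ContinuousLinearMap.inl ℝ E ℝ))
    (bound := fun _ => C)
    (Metric.closedBall_mem_nhds x₀ one_pos) ?_ ?_ ?_ ?_ ?_ ?_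
  · exact .of_forall fun x => (hF.continuous.comp (by fun_prop : Continuous fun t : ℝ => (x, t))).aestronglyMeasurable
  · exact (hF.continuous.comp (by fun_prop : Continuous fun t : ℝ => (x₀, t))).intervalIntegrable _ _
  · exact (hF'.comp (by fun_prop : Continuous fun t : ℝ => (x₀, t))).aestronglyMeasurable
  · exact .of_forall fun t ht x hx => hC (x, t) ⟨hx, uIoc_subset_uIcc ht⟩
  · exact intervalIntegrable_const
  · refine .of_forall fun t ht x hx => ?_
    exact (hF.differentiable one_ne_zero (x, t)).hasFDerivAt.comp x (hasFDerivAt_prodMk_left x t)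

/-- Induction on `n`: the derivative of the integral is the integral of the derivative. The target
`G` is quantified inside the induction because the derivative takes values in `E →L[ℝ] G`. -/
theorem contDiff_intervalIntegral {E : Type} [NormedAddCommGroup E]
    [NormedSpace ℝ E] [FiniteDimensional ℝ E] (a b : ℝ) (n : ℕ) :
    ∀ {G : Type} [NormedAddCommGroup G] [NormedSpace ℝ G] {F : E × ℝ → G}, ContDiff ℝ n F →
    ContDiff ℝ n (fun x => ∫ t in a..b, F (x, t)) := by
  induction n with
  | zero =>
    intro G _ _ F hF
    rw [Nat.cast_zero, contDiff_zero] at hF ⊢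
    exact intervalIntegral.continuous_parametric_intervalIntegral_of_continuous'
      (f := fun x t => F (x, t)) hF a b
  | succ n ih =>
    intro G _ _ F hF
    have h1 : ContDiff ℝ 1 F := hF.of_le (by exact_mod_cast Nat.le_add_left 1 n)
    have hd := hasFDerivAt_intervalIntegral_of_contDiff h1 a b
    have h2 : ContDiff ℝ n fun z : E × ℝ =>
        (fderiv ℝ F z).comp (ContinuousLinearMap.inl ℝ E ℝ) :=
      (hF.fderiv_right (by simp)).clm_comp contDiff_const
    push_cast
    refine contDiff_succ_iff_fderiv.2 ⟨fun x => (hd x).differentiableAt, by simp, ?_⟩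
    rw [funext fun x => (hd x).fderiv]
    exact ih h2

/-- **Hadamard's lemma**: a smooth function whose value and derivative vanish at `x₀` is a
combination of the coordinates `y ↦ y j - x₀ j` with smooth coefficients vanishing at `x₀`. -/
theorem exists_eq_sum_of_fderiv_eq_zero {m : ℕ} {u : EuclideanSpace ℝ (Fin m) → ℝ}
    (hu : ContDiff ℝ ∞ u) {x₀ : EuclideanSpace ℝ (Fin m)} (h0 : u x₀ = 0)
    (h1 : fderiv ℝ u x₀ = 0) :
    ∃ g : Fin m → EuclideanSpace ℝ (Fin m) → ℝ, (∀ j, ContDiff ℝ ∞ (g j)) ∧ (∀ j, g j x₀ = 0) ∧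
      ∀ y, u y = ∑ j, g j y * (y j - x₀ j) := by
  -- `∂_j u` along the segment from `x₀` to `y`. Integrating `d/dt u(x₀ + t(y - x₀))` over `[0, 1]`
  -- gives the decomposition; at `y = x₀` the segment is constant, and there `∂_j u` vanishes.
  let G (j : Fin m) (z : EuclideanSpace ℝ (Fin m) × ℝ) : ℝ :=
    fderiv ℝ u (x₀ + z.2 • (z.1 - x₀)) (EuclideanSpace.single j 1)
  have hG (j) : ContDiff ℝ ∞ (G j) :=
    ((hu.fderiv_right (m := ∞) (by simp)).comp (g := fderiv ℝ u)
      (f := fun z : EuclideanSpace ℝ (Fin m) × ℝ => x₀ + z.2 • (z.1 - x₀))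
      (contDiff_const.add (contDiff_snd.smul (contDiff_fst.sub contDiff_const)))).clm_apply
      contDiff_const
  refine ⟨fun j y => ∫ t in (0 : ℝ)..1, G j (y, t), fun j => ?_, fun j => ?_, fun y => ?_⟩
  · exact contDiff_infty.2 fun n => contDiff_intervalIntegral 0 1 n (contDiff_infty.1 (hG j) n)
  · simp [G, h1]
  · have hline (t : ℝ) : HasDerivAt (fun t : ℝ => u (x₀ + t • (y - x₀)))
        (fderiv ℝ u (x₀ + t • (y - x₀)) (y - x₀)) t := by
      have h : HasDerivAt (fun t : ℝ => x₀ + t • (y - x₀)) (y - x₀) t := by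
        simpa using ((hasDerivAt_id t).smul_const (y - x₀)).const_add x₀
      exact ((hu.differentiable (by simp) _).hasFDerivAt).comp_hasDerivAt t h
    have hsum (t : ℝ) : fderiv ℝ u (x₀ + t • (y - x₀)) (y - x₀) =
        ∑ j, G j (y, t) * (y j - x₀ j) := by
      have : y - x₀ = ∑ j, (y j - x₀ j) • EuclideanSpace.single j (1 : ℝ) := by
        ext i; simp [Finset.sum_apply, Pi.single_apply]
      conv_lhs => enter [2]; rw [this]
      rw [map_sum]
      exact Finset.sum_congr rfl fun j _ => by rw [map_smul, smul_eq_mul, mul_comm]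
    have hcont (j) : Continuous fun t : ℝ => G j (y, t) * (y j - x₀ j) :=
      ((hG j).continuous.comp (by fun_prop : Continuous fun t : ℝ => (y, t))).mul continuous_const
    have hint := intervalIntegral.integral_eq_sub_of_hasDerivAt (a := 0) (b := 1)
      (fun t _ => hline t) (by
        simp only [hsum]
        exact (continuous_finsetSum _ fun j _ => hcont j).intervalIntegrable _ _)
    simp only [hsum, one_smul, zero_smul, add_zero, add_sub_cancel, h0, sub_zero] at hint
    rw [← hint, intervalIntegral.integral_finsetSum fun j _ => (hcont j).intervalIntegrable _ _]
    exact Finset.sum_congr rfl fun j _ => intervalIntegral.integral_mul_const _ _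

end Hadamard

/-! ### Derivations of `C^∞(M)` see only the differential. -/

section Derivations

variable {m : ℕ} {M : Type*} [TopologicalSpace M] [ChartedSpace (EuclideanSpace ℝ (Fin m)) M]
  (X : Derivation ℝ C^∞⟮𝓡 m, M; ℝ⟯ C^∞⟮𝓡 m, M; ℝ⟯) {p : M}

theorem Derivation.apply_mul_eval (f g : C^∞⟮𝓡 m, M; ℝ⟯) (p : M) :
    X (f * g) p = f p * X g p + g p * X f p := by
  rw [X.leibniz]; rfl

variable [IsManifold (𝓡 m) ∞ M] [T2Space M]

/-- Derivations of `C^∞(M)` are local. -/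
theorem Derivation.apply_eq_zero_of_eventuallyEq {f : C^∞⟮𝓡 m, M; ℝ⟯}
    (hf : (f : M → ℝ) =ᶠ[𝓝 p] 0) : X f p = 0 := by
  obtain ⟨U, hU, hUo, hp⟩ := eventually_nhds_iff.1 hf
  -- `χ` is 1 near `p` and 0 wherever `f` may be nonzero, so `f χ = 0`; the Leibniz rule at `p` then
  -- leaves `X f p = 0`.
  obtain ⟨χ, hχ, hχ0⟩ := exists_contMDiffMap_eventuallyEq (g := fun _ => (1 : ℝ)) hUo hp
    (contMDiffOn_const (I := 𝓡 m))
  have h : f * χ = 0 := by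
    ext q
    by_cases hq : q ∈ U
    · simp [show f q = 0 from hU q hq]
    · simp [hχ0 q hq]
  have h2 := X.apply_mul_eval f χ p
  rw [h, map_zero, show f p = 0 from hf.eq_of_nhds, show χ p = 1 from hχ.eq_of_nhds] at h2
  simpa using h2.symm

theorem Derivation.apply_eq_of_eventuallyEq {f g : C^∞⟮𝓡 m, M; ℝ⟯}
    (hf : (f : M → ℝ) =ᶠ[𝓝 p] g) : X f p = X g p := by
  have h : X (f - g) p = 0 := X.apply_eq_zero_of_eventuallyEq (by
    filter_upwards [hf] with q hq
    simp [hq])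
  rw [map_sub] at h
  exact sub_eq_zero.1 h

/-- A derivation applied to a function with vanishing differential vanishes. -/
theorem Derivation.apply_eq_zero_of_mvfderiv_eq_zero {f : C^∞⟮𝓡 m, M; ℝ⟯}
    (hf : mvfderiv (𝓡 m) f p = 0) : X f p = 0 := by
  have hφ := IsManifold.chart_mem_maximalAtlas (I := 𝓡 m) (n := ∞) p
  have hp := mem_chart_source (EuclideanSpace ℝ (Fin m)) p
  set φ := chartAt (EuclideanSpace ℝ (Fin m)) p
  obtain ⟨x, hx⟩ := exists_isCoordGerm hφ hp
  -- Hadamard's lemma needs a function on all of `ℝᵐ`, since the chart target need not be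
  -- star-shaped; hence the cut-off.
  obtain ⟨u, hu, -⟩ := exists_contMDiffMap_eventuallyEq (M := EuclideanSpace ℝ (Fin m))
    (g := fun y => f (φ.symm y) - f p) φ.open_target (φ.map_source hp) fun y hy =>
      ((contDiffAt_comp_chart_symm hφ hy f.contMDiff.contMDiffAt).sub
        contDiffAt_const).contMDiffAt.contMDiffWithinAt
  have hfd : fderiv ℝ (f ∘ φ.symm) (φ p) = 0 := by
    ext v
    rw [← mvfderiv_mfderiv_chart_symm hφ hp, hf]; rfl
  obtain ⟨g, hg, hg0, hgu⟩ := exists_eq_sum_of_fderiv_eq_zero u.contMDiff.contDiff (x₀ := φ p)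
    (by rw [hu.eq_of_nhds, φ.left_inv hp, sub_self]) (by
      rw [hu.fderiv_eq]
      exact (fderiv_sub_const _).trans hfd)
  have hg' (j) := exists_contMDiffMap_eventuallyEq (g := fun q => g j (φ q)) φ.open_source hp
    fun q hq => (contMDiffAt_comp_chart hφ hq (hg j).contDiffAt).contMDiffWithinAt
  choose G hG _ using hg'
  -- Apart from a constant, `f` is near `p` a sum of products of two functions vanishing at `p`, and
  -- the Leibniz rule kills each product.
  have hfG : (f : M → ℝ) =ᶠ[𝓝 p] (algebraMap ℝ C^∞⟮𝓡 m, M; ℝ⟯ (f p) +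
      ∑ j, G j * (x j - algebraMap ℝ C^∞⟮𝓡 m, M; ℝ⟯ (φ p j)) : C^∞⟮𝓡 m, M; ℝ⟯) := by
    have hc : Filter.Tendsto φ (𝓝 p) (𝓝 (φ p)) := φ.continuousAt hp
    filter_upwards [hc.eventually hu, Filter.eventually_all.2 hG, Filter.eventually_all.2 hx,
      φ.open_source.mem_nhds hp] with q h1 h2 h3 h4
    rw [φ.left_inv h4, hgu] at h1
    have e : (algebraMap ℝ C^∞⟮𝓡 m, M; ℝ⟯ (f p) +
      ∑ j, G j * (x j - algebraMap ℝ C^∞⟮𝓡 m, M; ℝ⟯ (φ p j)) : C^∞⟮𝓡 m, M; ℝ⟯) q =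
        f p + ∑ j, G j q * (x j q - φ p j) := by
      rw [ContMDiffMap.coe_add, Pi.add_apply, ContMDiffMap.sum_eval]
      rfl
    rw [e]
    simp only [h2, h3, h1]
    ring
  rw [X.apply_eq_of_eventuallyEq hfG, map_add, ContMDiffMap.coe_add, Pi.add_apply,
    map_sum, ContMDiffMap.sum_eval, X.map_algebraMap]
  have hz (j) : X (G j * (x j - algebraMap ℝ C^∞⟮𝓡 m, M; ℝ⟯ (φ p j))) p = 0 := by
    rw [X.apply_mul_eval, show G j p = 0 from (hG j).eq_of_nhds.trans (hg0 j)]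
    have : (x j - algebraMap ℝ C^∞⟮𝓡 m, M; ℝ⟯ (φ p j)) p = x j p - φ p j := rfl
    rw [this, (hx j).eq_of_nhds]
    ring
  rw [Finset.sum_eq_zero fun j _ => hz j, add_zero]
  rfl

/-- A derivation in terms of functions whose differentials at `p` span. -/
theorem Derivation.apply_eq_sum {ι : Type*} [Fintype ι] {h : ι → C^∞⟮𝓡 m, M; ℝ⟯}
    {f : C^∞⟮𝓡 m, M; ℝ⟯} {c : ι → ℝ}
    (hf : mvfderiv (𝓡 m) f p = ∑ i, c i • mvfderiv (𝓡 m) (h i) p) :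
    X f p = ∑ i, c i * X (h i) p := by
  have h0 : X (f - ∑ i, c i • h i) p = 0 := X.apply_eq_zero_of_mvfderiv_eq_zero (by
    rw [← ContMDiffMap.differential_apply, map_sub, map_sum]
    rw [Finset.sum_congr rfl fun i _ => (ContMDiffMap.differential p).map_smul (c i) (h i)]
    simp only [ContMDiffMap.differential_apply, hf, sub_self])
  rw [map_sub, ContMDiffMap.coe_sub, Pi.sub_apply, map_sum, ContMDiffMap.sum_eval, sub_eq_zero] at h0
  rw [h0]
  exact Finset.sum_congr rfl fun i _ => by rw [map_smul]; rfl

end Derivations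

/-! ### Finitely many functions whose differentials separate tangent vectors. -/

section Immersion

open Module Set

variable {m : ℕ} {M : Type*} [TopologicalSpace M] [ChartedSpace (EuclideanSpace ℝ (Fin m)) M]

/-- The differentials of the functions `h i` separate the tangent vectors at each point of `S`. -/
def SeparatesTangentOn {ι : Type*} (h : ι → C^∞⟮𝓡 m, M; ℝ⟯) (S : Set M) : Prop :=
  ∀ p ∈ S, ∀ v : TangentSpace (𝓡 m) p, (∀ i, mvfderiv (𝓡 m) (h i) p v = 0) → v = 0

theorem IsCoordGerm.eq_zero_of_mvfderiv {φ : OpenPartialHomeomorph M (EuclideanSpace ℝ (Fin m))}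
    (hφ : φ ∈ IsManifold.maximalAtlas (𝓡 m) ∞ M) {p : M} {x : Fin m → C^∞⟮𝓡 m, M; ℝ⟯}
    (hx : IsCoordGerm φ p x) (hp : p ∈ φ.source) {v : TangentSpace (𝓡 m) p}
    (hv : ∀ j, mvfderiv (𝓡 m) (x j) p v = 0) : v = 0 := by
  rw [hx.sum_smul_coordVector hφ hp v]
  exact Finset.sum_eq_zero fun j _ => by rw [hv, zero_smul]

/-- The possible values of `(df_i(v))_i`, over all tangent vectors `v` with base point in the
domain of a chart, form a set of dimension at most `2m`. -/
theorem dimH_mvfderiv_image_le {φ : OpenPartialHomeomorph M (EuclideanSpace ℝ (Fin m))}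
    (hφ : φ ∈ IsManifold.maximalAtlas (𝓡 m) ∞ M) {N : ℕ} (f : Fin N → C^∞⟮𝓡 m, M; ℝ⟯) :
    dimH {c : Fin N → ℝ | ∃ p ∈ φ.source, ∃ v : TangentSpace (𝓡 m) p,
      c = fun i => mvfderiv (𝓡 m) (f i) p v} ≤ (2 * m : ℕ) := by
  -- In the chart the tangent bundle is an open subset of `ℝ²ᵐ`, and `F` is `C¹`, hence locally
  -- Lipschitz, so it does not raise Hausdorff dimension.
  let F (z : EuclideanSpace ℝ (Fin m) × EuclideanSpace ℝ (Fin m)) : Fin N → ℝ :=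
    fun i => fderiv ℝ (f i ∘ φ.symm) z.1 z.2
  have hsub : {c : Fin N → ℝ | ∃ p ∈ φ.source, ∃ v : TangentSpace (𝓡 m) p,
      c = fun i => mvfderiv (𝓡 m) (f i) p v} ⊆ F '' (φ.target ×ˢ univ) := by
    rintro _ ⟨p, hp, v, rfl⟩
    refine ⟨(φ p, (mfderiv (𝓡 m) (𝓡 m) φ p v : EuclideanSpace ℝ (Fin m))),
      ⟨φ.map_source hp, mem_univ _⟩, funext fun i => ?_⟩
    refine (mvfderiv_mfderiv_chart_symm hφ hp (f i) _).symm.trans ?_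
    exact congrArg (mvfderiv (𝓡 m) (f i) p) (DFunLike.congr_fun
      ((mdifferentiable_of_mem_maximalAtlas hφ).symm_comp_deriv hp) v)
  have hF : ∀ z ∈ φ.target ×ˢ (univ : Set (EuclideanSpace ℝ (Fin m))), ContDiffAt ℝ 1 F z := by
    rintro ⟨y, w⟩ ⟨hy, -⟩
    refine contDiffAt_pi.2 fun i => ?_
    have h1 : ContDiffAt ℝ 1 (fderiv ℝ (f i ∘ φ.symm)) y :=
      ((contDiffAt_comp_chart_symm hφ hy (f i).contMDiff.contMDiffAt).fderiv_right (m := ∞)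
        (by simp)).of_le (by simp)
    exact (h1.comp (y, w) contDiffAt_fst).clm_apply contDiffAt_snd
  calc _ ≤ dimH (F '' (φ.target ×ˢ univ)) := dimH_mono hsub
    _ ≤ dimH (φ.target ×ˢ (univ : Set (EuclideanSpace ℝ (Fin m)))) := by
      refine dimH_image_le_of_locally_lipschitzOn fun z hz => ?_
      obtain ⟨K, t, ht, hK⟩ := (hF z hz).exists_lipschitzOnWith
      exact ⟨K, t, mem_nhdsWithin_of_mem_nhds ht, hK⟩
    _ ≤ dimH (univ : Set (EuclideanSpace ℝ (Fin m) × EuclideanSpace ℝ (Fin m))) :=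
      dimH_mono (subset_univ _)
    _ = (2 * m : ℕ) := by
      rw [Real.dimH_univ_eq_finrank, finrank_prod, finrank_euclideanSpace_fin, two_mul]

variable [IsManifold (𝓡 m) ∞ M]

/-- More than `2m + 1` functions that separate tangent vectors can be replaced by one fewer. -/
theorem SeparatesTangentOn.exists_sub [SecondCountableTopology M] {N : ℕ} (hN : 2 * m < N)
    {h : Fin (N + 1) → C^∞⟮𝓡 m, M; ℝ⟯} {S : Set M} (hh : SeparatesTangentOn h S) :
    ∃ c : Fin N → ℝ,
      SeparatesTangentOn (fun i : Fin N => h i.castSucc - c i • h (Fin.last N)) S := by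
  obtain ⟨s, hs, hcov⟩ := TopologicalSpace.countable_cover_nhds
    (fun q : M => chart_source_mem_nhds (EuclideanSpace ℝ (Fin m)) q)
  -- The bad choices of `c`: if the new differentials kill `v` but `dh_last(v) ≠ 0`, then `c` is the
  -- vector of values `dh_i` on `v / dh_last(v)`. Countably many sets of dimension at most `2m < N`
  -- cannot fill `ℝᴺ`.
  let B (q : M) : Set (Fin N → ℝ) :=
    {c | ∃ p ∈ (chartAt (EuclideanSpace ℝ (Fin m)) q).source, ∃ v : TangentSpace (𝓡 m) p,
      c = fun i => mvfderiv (𝓡 m) (h (Fin.castSucc i)) p v}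
  have hB : dimH (⋃ q ∈ s, B q) < finrank ℝ (Fin N → ℝ) := by
    rw [dimH_bUnion hs]
    refine lt_of_le_of_lt (iSup₂_le fun q _ => dimH_mvfderiv_image_le
      (IsManifold.chart_mem_maximalAtlas q) fun i => h (Fin.castSucc i)) ?_
    rw [finrank_fin_fun]
    exact_mod_cast hN
  obtain ⟨c, hc⟩ := (dense_compl_of_dimH_lt_finrank hB).nonempty
  refine ⟨c, fun p hp v hv => hh p hp v ?_⟩
  have hv' (i : Fin N) : mvfderiv (𝓡 m) (h i.castSucc) p v =
      c i * mvfderiv (𝓡 m) (h (Fin.last N)) p v := by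
    have := hv i
    rw [← ContMDiffMap.differential_apply, map_sub, map_smul] at this
    exact sub_eq_zero.1 this
  have h0 : mvfderiv (𝓡 m) (h (Fin.last N)) p v = 0 := by
    by_contra hne
    obtain ⟨q, hq, hpq⟩ := mem_iUnion₂.1 (hcov ▸ mem_univ p)
    refine hc (mem_iUnion₂.2 ⟨q, hq, p, hpq, (mvfderiv (𝓡 m) (h (Fin.last N)) p v)⁻¹ • v,
      funext fun i => ?_⟩)
    rw [map_smul, hv' i, smul_eq_mul]
    field_simp
  intro i
  induction i using Fin.lastCases with
  | last => exact h0
  | cast i => rw [hv', h0, mul_zero]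

/-- Long families are shortened one function at a time, short ones padded with zeros. The count `2m
+ 1` is independent of `S`, which is what permits gluing infinitely many pieces into finitely many
functions. -/
theorem SeparatesTangentOn.exists_fin [SecondCountableTopology M] {S W : Set M} :
    ∀ {N : ℕ} {h : Fin N → C^∞⟮𝓡 m, M; ℝ⟯}, SeparatesTangentOn h S → (∀ i, ∀ q ∉ W, h i q = 0) →
      ∃ h' : Fin (2 * m + 1) → C^∞⟮𝓡 m, M; ℝ⟯,
        SeparatesTangentOn h' S ∧ ∀ i, ∀ q ∉ W, h' i q = 0 := by
  intro N
  induction N with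
  | zero =>
    intro h hh _
    exact ⟨fun _ => 0, fun p hp v _ => hh p hp v fun i => i.elim0, fun _ _ _ => rfl⟩
  | succ N ih =>
    intro h hh hW
    by_cases hN : 2 * m < N
    · obtain ⟨c, hc⟩ := hh.exists_sub hN
      refine ih hc fun i q hq => ?_
      have : (h i.castSucc - c i • h (Fin.last N)) q =
        h i.castSucc q - c i * h (Fin.last N) q := rfl
      rw [this, hW _ q hq, hW _ q hq, mul_zero, sub_zero]
    · refine ⟨fun i => if hi : (i : ℕ) < N + 1 then h ⟨i, hi⟩ else 0, fun p hp v hv => ?_,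
        fun i q hq => ?_⟩
      · refine hh p hp v fun i => ?_
        simpa only [i.2, dite_true] using hv ⟨i, by omega⟩
      · dsimp only
        split_ifs with hi
        · exact hW _ q hq
        · rfl

/-- Coordinate functions cut off to `W`, over a finite subcover of `K`, separate tangent vectors;
their number is then reduced. -/
theorem exists_separatesTangentOn_of_isCompact [SecondCountableTopology M] [T2Space M]
    {K W : Set M} (hK : IsCompact K) (hW : IsOpen W) (hKW : K ⊆ W) :
    ∃ h : Fin (2 * m + 1) → C^∞⟮𝓡 m, M; ℝ⟯,
      SeparatesTangentOn h K ∧ ∀ i, ∀ q ∉ W, h i q = 0 := by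
  have hloc (p : K) : ∃ x : Fin m → C^∞⟮𝓡 m, M; ℝ⟯,
      IsCoordGerm (chartAt (EuclideanSpace ℝ (Fin m)) (p : M)) p x ∧
        ∀ j, ∀ q ∉ W, x j q = 0 := by
    set φ := chartAt (EuclideanSpace ℝ (Fin m)) (p : M)
    have (j : Fin m) := exists_contMDiffMap_eventuallyEq (g := fun q => φ q j)
      (φ.open_source.inter hW) ⟨mem_chart_source _ (p : M), hKW p.2⟩ fun q hq =>
        (contMDiffAt_comp_chart (IsManifold.chart_mem_maximalAtlas (I := 𝓡 m) (n := ∞) (p : M))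
          hq.1 (u := fun y => y j) (by fun_prop)).contMDiffWithinAt
    choose x hx hx0 using this
    exact ⟨x, hx, fun j q hq => hx0 j q fun h => hq h.2⟩
  choose x hx hx0 using hloc
  let V (p : K) : Set M := {q | IsCoordGerm (chartAt (EuclideanSpace ℝ (Fin m)) (p : M)) q (x p)} ∩
    (chartAt (EuclideanSpace ℝ (Fin m)) (p : M)).source
  obtain ⟨t, ht⟩ := hK.elim_nhds_subcover' (fun p hp => V ⟨p, hp⟩) fun p hp =>
    Filter.inter_mem (hx ⟨p, hp⟩).eventually (chart_source_mem_nhds _ p)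
  let e := Fintype.equivFin (t × Fin m)
  refine SeparatesTangentOn.exists_fin (h := fun i => x (e.symm i).1 (e.symm i).2)
    (fun p hp v hv => ?_) fun i q hq => hx0 _ _ q hq
  obtain ⟨q, hq, hpq⟩ := mem_iUnion₂.1 (ht hp)
  refine hpq.1.eq_zero_of_mvfderiv (IsManifold.chart_mem_maximalAtlas _) hpq.2 fun j => ?_
  simpa using hv (e (⟨q, hq⟩, j))

/-- On every manifold there are finitely many smooth functions whose differentials separate the
tangent vectors. -/
theorem exists_separatesTangentOn_univ (m : ℕ) (M : Type*) [TopologicalSpace M]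
    [ChartedSpace (EuclideanSpace ℝ (Fin m)) M] [IsManifold (𝓡 m) ∞ M]
    [SecondCountableTopology M] [T2Space M] :
    ∃ h : Fin 3 × Fin (2 * m + 1) → C^∞⟮𝓡 m, M; ℝ⟯, SeparatesTangentOn h univ := by
  have : LocallyCompactSpace M := ChartedSpace.locallyCompactSpace (EuclideanSpace ℝ (Fin m)) M
  let K₀ : CompactExhaustion M := default
  -- The shift makes `K 0` empty, so the shells start from nothing and the truncated `K (0 - 1) = K
  -- 0` below removes nothing.
  let K := K₀.shiftr
  -- Open neighbourhoods of the compact shells `K (n + 1) \ interior (K n)`, pairwise disjoint once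
  -- the indices differ by at least 3.
  let W (n : ℕ) : Set M := interior (K (n + 2)) \ K (n - 1)
  have hdisj {i j : ℕ} {q : M} (hi : q ∈ W i) (hj : q ∈ W j) : j < i + 3 := by
    by_contra hij
    exact hj.2 (K.subset (by omega) (interior_subset hi.1))
  have hex (n : ℕ) := exists_separatesTangentOn_of_isCompact (m := m) (M := M)
    (K := K (n + 1) \ interior (K n)) (W := W n) ((K.isCompact _).diff isOpen_interior)
    (isOpen_interior.sdiff (K.isCompact _).isClosed) (by
      rintro q ⟨hq, hq'⟩
      refine ⟨K.subset_interior_succ _ hq, fun h => hq' ?_⟩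
      cases n with
      | zero => exact absurd h (notMem_empty q)
      | succ n => exact K.subset_interior_succ _ h)
  choose h hsep hW using hex
  -- Distinct indices with the same residue mod 3 differ by at least 3, so on `W n` the sum over the
  -- residue class of `n` reduces to its `n`-th term.
  let g (c : Fin 3 × Fin (2 * m + 1)) (n : ℕ) : C^∞⟮𝓡 m, M; ℝ⟯ :=
    if n % 3 = c.1 then h n c.2 else 0
  have hg0 (c n q) (hq : q ∉ W n) : g c n q = 0 := by
    dsimp only [g]
    split_ifs
    · exact hW n _ q hq
    · rfl
  have hfin (c) : LocallyFinite fun n => Function.support (g c n) := by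
    intro p
    obtain ⟨n, hn⟩ := K.exists_mem_nhds p
    refine ⟨K n, hn, (finite_lt_nat (n + 2)).subset ?_⟩
    rintro i ⟨q, hq, hqn⟩
    by_contra hi
    have hqW : q ∈ W i := by
      by_contra h'
      exact hq (hg0 c i q h')
    exact hqW.2 (K.subset (by simp at hi; omega) hqn)
  refine ⟨fun c => ⟨fun q => ∑ᶠ n, g c n q, contMDiff_finsum (fun n => (g c n).contMDiff) (hfin c)⟩,
    fun p _ v hv => ?_⟩
  have hp := K₀.mem_sdiff_shiftr_find p
  set n := K₀.find p
  have hpn : p ∈ K (n + 1) \ interior (K n) := ⟨hp.1, fun h => hp.2 (interior_subset h)⟩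
  have hpW : p ∈ W n := ⟨K.subset_interior_succ _ hpn.1, fun h => hp.2 (K.subset (n.sub_le 1) h)⟩
  refine hsep n p hpn v fun a => ?_
  rw [← hv (⟨n % 3, Nat.mod_lt _ (by norm_num)⟩, a)]
  congr 1
  refine mvfderiv_congr ?_
  filter_upwards [(isOpen_interior.sdiff (K.isCompact _).isClosed).mem_nhds hpW] with q hq
  refine Eq.symm ((finsum_eq_single _ n fun i hi => ?_).trans (by simp [g]))
  by_cases hqi : q ∈ W i
  · have h1 := hdisj hq hqi
    have h2 := hdisj hqi hq
    have : ¬ i % 3 = n % 3 := by omega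
    simp [g, this]
  · exact hg0 _ _ _ hqi

end Immersion

/-! ### Gradient derivations for the induced metric. -/

section DualDerivations

open Module Set

variable {m : ℕ} {M : Type*} [TopologicalSpace M] [ChartedSpace (EuclideanSpace ℝ (Fin m)) M]
  {ι : Type*} [Fintype ι]

/-- `w` is the gradient of `h i` at `p` for the metric `∑ j, dh_j ⊗ dh_j`. -/
def IsGradientAt (h : ι → C^∞⟮𝓡 m, M; ℝ⟯) (i : ι) (p : M) (w : TangentSpace (𝓡 m) p) : Prop :=
  ∀ v, ∑ j, mvfderiv (𝓡 m) (h j) p w * mvfderiv (𝓡 m) (h j) p v = mvfderiv (𝓡 m) (h i) p v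

/-- Separation makes `∑ dh_j ⊗ dh_j` positive definite; test with `w - w'`. -/
theorem SeparatesTangentOn.eq_of_sum_mul_eq {h : ι → C^∞⟮𝓡 m, M; ℝ⟯}
    (hh : SeparatesTangentOn h univ) {p : M} {w w' : TangentSpace (𝓡 m) p}
    (hw : ∀ v, ∑ j, mvfderiv (𝓡 m) (h j) p w * mvfderiv (𝓡 m) (h j) p v =
      ∑ j, mvfderiv (𝓡 m) (h j) p w' * mvfderiv (𝓡 m) (h j) p v) : w = w' := by
  refine sub_eq_zero.1 (hh p (mem_univ _) _ fun i => ?_)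
  have h0 : ∑ j, mvfderiv (𝓡 m) (h j) p (w - w') * mvfderiv (𝓡 m) (h j) p (w - w') = 0 := by
    have := sub_eq_zero.2 (hw (w - w'))
    rw [← Finset.sum_sub_distrib] at this
    rw [← this]
    exact Finset.sum_congr rfl fun j _ => by rw [← sub_mul, ← map_sub]
  exact mul_self_eq_zero.1
    ((Finset.sum_eq_zero_iff_of_nonneg fun j _ => mul_self_nonneg _).1 h0 i (Finset.mem_univ _))

/-- In coordinates the metric is an invertible operator `B y`, and the gradient of `h i` is `B⁻¹`
applied to `dh_i`; it is smooth because inversion of operators is. -/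
theorem SeparatesTangentOn.exists_isGradientAt_chart {h : ι → C^∞⟮𝓡 m, M; ℝ⟯}
    (hh : SeparatesTangentOn h univ) (i : ι)
    {φ : OpenPartialHomeomorph M (EuclideanSpace ℝ (Fin m))}
    (hφ : φ ∈ IsManifold.maximalAtlas (𝓡 m) ∞ M) :
    ∃ e : EuclideanSpace ℝ (Fin m) → EuclideanSpace ℝ (Fin m),
      (∀ y ∈ φ.target, ContDiffAt ℝ ∞ e y) ∧
      ∀ p ∈ φ.source, IsGradientAt h i p (mfderiv (𝓡 m) (𝓡 m) φ.symm (φ p) (e (φ p))) := by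
  have hd := mdifferentiable_of_mem_maximalAtlas hφ
  let b (j : ι) (y : EuclideanSpace ℝ (Fin m)) : EuclideanSpace ℝ (Fin m) →L[ℝ] ℝ :=
    fderiv ℝ (h j ∘ φ.symm) y
  let B (y : EuclideanSpace ℝ (Fin m)) :
      EuclideanSpace ℝ (Fin m) →L[ℝ] EuclideanSpace ℝ (Fin m) →L[ℝ] ℝ :=
    ∑ j, (b j y).smulRight (b j y)
  have hB (y v w) : B y v w = ∑ j, b j y v * b j y w := by
    simp [B, sum_apply]
  have hb {y} (hy : y ∈ φ.target) (j) : ContDiffAt ℝ ∞ (b j) y :=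
    (contDiffAt_comp_chart_symm hφ hy (h j).contMDiff.contMDiffAt).fderiv_right (by simp)
  have hinj {y} (hy : y ∈ φ.target) : Function.Injective (B y) := by
    refine (injective_iff_map_eq_zero _).2 fun v hv => ?_
    have h0 : ∑ j, b j y v * b j y v = 0 := by rw [← hB, hv]; rfl
    have h1 (j) : b j y v = 0 := mul_self_eq_zero.1
      ((Finset.sum_eq_zero_iff_of_nonneg fun j _ => mul_self_nonneg _).1 h0 j (Finset.mem_univ _))
    obtain ⟨p, hp, rfl⟩ : ∃ p ∈ φ.source, φ p = y := ⟨φ.symm y, φ.map_target hy, φ.right_inv hy⟩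
    have h2 : mfderiv (𝓡 m) (𝓡 m) φ.symm (φ p) v = 0 := by
      refine hh _ (mem_univ _) _ fun j => ?_
      have e := mvfderiv_mfderiv_chart_symm hφ hp (h j) v
      rw [φ.left_inv hp]
      exact e.trans (h1 j)
    exact (injective_iff_map_eq_zero _).1 (hd.symm.mfderiv_injective hy) v h2
  have hequiv {y} (hy : y ∈ φ.target) : ∃ E : EuclideanSpace ℝ (Fin m) ≃L[ℝ]
      (EuclideanSpace ℝ (Fin m) →L[ℝ] ℝ), (E : _ →L[ℝ] _) = B y := by
    have hfin : finrank ℝ (EuclideanSpace ℝ (Fin m)) =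
        finrank ℝ (EuclideanSpace ℝ (Fin m) →L[ℝ] ℝ) := by
      rw [← LinearEquiv.finrank_eq (LinearMap.toContinuousLinearMap (𝕜 := ℝ)
        (E := EuclideanSpace ℝ (Fin m)) (F' := ℝ))]
      exact Subspace.dual_finrank_eq.symm
    refine ⟨(LinearEquiv.ofInjectiveOfFinrankEq (B y).toLinearMap (hinj hy)
      hfin).toContinuousLinearEquiv, ?_⟩
    ext v : 1
    rfl
  -- `inverse` is zero on operators that are not invertible, so `hequiv` is needed both for
  -- smoothness and for the defining equation.
  refine ⟨fun y => (B y).inverse (b i y), fun y hy => ?_, fun p hp v => ?_⟩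
  · obtain ⟨E, hE⟩ := hequiv hy
    have h1 : ContDiffAt ℝ ∞ B y := by
      refine ContDiffAt.sum fun j _ => ?_
      exact (hb hy j).smulRight (hb hy j)
    have h2 : ContDiffAt ℝ ∞ (ContinuousLinearMap.inverse ∘ B) y :=
      ContDiffAt.comp y (hE ▸ contDiffAt_map_inverse E) h1
    exact h2.clm_apply (hb hy i)
  · obtain ⟨E, hE⟩ := hequiv (φ.map_source hp)
    have h1 : B (φ p) ((B (φ p)).inverse (b i (φ p))) = b i (φ p) := by
      rw [← hE, ContinuousLinearMap.inverse_equiv]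
      exact E.apply_symm_apply _
    obtain ⟨w, rfl⟩ : ∃ w : EuclideanSpace ℝ (Fin m),
        mfderiv (𝓡 m) (𝓡 m) φ.symm (φ p) w = v :=
      ⟨mfderiv (𝓡 m) (𝓡 m) φ p v, DFunLike.congr_fun (hd.symm_comp_deriv hp) v⟩
    refine (Finset.sum_congr rfl fun j _ => congrArg₂ (· * ·)
      (mvfderiv_mfderiv_chart_symm hφ hp (h j) _)
      (mvfderiv_mfderiv_chart_symm hφ hp (h j) _)).trans ?_
    refine Eq.trans ?_ (mvfderiv_mfderiv_chart_symm hφ hp (h i) w).symm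
    rw [← hB, h1]

variable [IsManifold (𝓡 m) ∞ M]

/-- If the differentials of the functions `h i` separate tangent vectors, there are derivations
`Y i` with `df = ∑ i, (Y i f) dh_i` for all `f`. -/
theorem SeparatesTangentOn.exists_derivation {h : ι → C^∞⟮𝓡 m, M; ℝ⟯}
    (hh : SeparatesTangentOn h univ) :
    ∃ Y : ι → Derivation ℝ C^∞⟮𝓡 m, M; ℝ⟯ C^∞⟮𝓡 m, M; ℝ⟯, ∀ (f : C^∞⟮𝓡 m, M; ℝ⟯) p,
      mvfderiv (𝓡 m) f p = ∑ i, Y i f p • mvfderiv (𝓡 m) (h i) p := by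
  have hex (i : ι) (p : M) : ∃ w, IsGradientAt h i p w := by
    obtain ⟨e, -, he⟩ := hh.exists_isGradientAt_chart i
      (IsManifold.chart_mem_maximalAtlas (I := 𝓡 m) (n := ∞) p)
    exact ⟨_, he p (mem_chart_source _ p)⟩
  choose w hw using hex
  have hsmooth (i : ι) (f : C^∞⟮𝓡 m, M; ℝ⟯) :
      ContMDiff (𝓡 m) 𝓘(ℝ, ℝ) ∞ fun p => mvfderiv (𝓡 m) f p (w i p) := by
    intro p
    have hφ := IsManifold.chart_mem_maximalAtlas (I := 𝓡 m) (n := ∞) p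
    have hp := mem_chart_source (EuclideanSpace ℝ (Fin m)) p
    obtain ⟨e, hes, he⟩ := hh.exists_isGradientAt_chart i hφ
    set φ := chartAt (EuclideanSpace ℝ (Fin m)) p
    -- `w` was chosen pointwise; uniqueness of gradients identifies it near `p` with the smooth
    -- field of the chart.
    have heq : (fun q => mvfderiv (𝓡 m) f q (w i q)) =ᶠ[𝓝 p]
        fun q => fderiv ℝ (f ∘ φ.symm) (φ q) (e (φ q)) := by
      filter_upwards [φ.open_source.mem_nhds hp] with q hq
      rw [hh.eq_of_sum_mul_eq fun v => (hw i q v).trans (he q hq v).symm]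
      exact mvfderiv_mfderiv_chart_symm hφ hq f _
    exact ContMDiffAt.congr_of_eventuallyEq ((contMDiffAt_fderiv_comp_symm hφ hp f).clm_apply
      (contMDiffAt_comp_chart hφ hp (hes _ (φ.map_source hp)))) heq
  refine ⟨fun i => Derivation.mk'
    { toFun := fun f => ⟨fun p => mvfderiv (𝓡 m) f p (w i p), hsmooth i f⟩
      map_add' := fun f g => ?_
      map_smul' := fun c f => ?_ } fun f g => ?_, fun f p => ?_⟩
  · ext p
    exact DFunLike.congr_fun ((ContMDiffMap.differential p).map_add f g) (w i p)
  · ext p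
    exact DFunLike.congr_fun ((ContMDiffMap.differential p).map_smul c f) (w i p)
  · ext p
    exact DFunLike.congr_fun (mvfderiv_mul (f.mdifferentiableAt_top p)
      (g.mdifferentiableAt_top p)) (w i p)
  · ext v
    -- Both sides have the same inner product with every `u`. Applying `df` gives the claim, as `Y i
    -- f = df(w i)`.
    have hv : v = ∑ i, mvfderiv (𝓡 m) (h i) p v • w i p := by
      refine hh.eq_of_sum_mul_eq fun u => ?_
      simp only [map_sum, map_smul, smul_eq_mul, Finset.sum_mul, mul_assoc]
      rw [Finset.sum_comm]
      simp only [← Finset.mul_sum, hw _ p u]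
    conv_lhs => rw [hv, map_sum]
    simp only [sum_apply, smul_apply, map_smul, smul_eq_mul]
    exact Finset.sum_congr rfl fun i _ => mul_comm _ _

end DualDerivations

/-! ### Algebra of multiderivations: products of derivations span. -/

section Multiderivations

variable {K : Type*} [CommRing K] {A : Type*} [CommRing A] [Algebra K A]

/-- The cochain `a₁ ⊗ ⋯ ⊗ aₙ ↦ X₁(a₁) ⋯ Xₙ(aₙ)`. -/
noncomputable def Derivation.prodCochain {n : ℕ} (X : Fin n → Derivation K A A) :
    HochschildCochain K A n :=
  PiTensorProduct.lift ((MultilinearMap.mkPiAlgebra K (Fin n) A).compLinearMap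
    fun k => (X k).toLinearMap)

theorem Derivation.prodCochain_tprod {n : ℕ} (X : Fin n → Derivation K A A) (a : Fin n → A) :
    prodCochain X (PiTensorProduct.tprod K a) = ∏ k, X k (a k) := by
  simp [prodCochain]

theorem Derivation.prodCochain_cup {i j : ℕ} (X : Fin i → Derivation K A A)
    (Y : Fin j → Derivation K A A) :
    (prodCochain X).cup (prodCochain Y) = prodCochain (Fin.append X Y) := by
  refine PiTensorProduct.ext (MultilinearMap.ext fun a => ?_)
  simp [HochschildCochain.cup_tprod, prodCochain_tprod, Fin.prod_univ_add]

theorem Derivation.prodCochain_one (X : Fin 1 → Derivation K A A) :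
    prodCochain X = (X 0).toCochain := by
  refine PiTensorProduct.ext (MultilinearMap.ext fun a => ?_)
  simp [prodCochain_tprod, toCochain]

theorem Derivation.of_prodCochain_mul {i j : ℕ} (X : Fin i → Derivation K A A)
    (Y : Fin j → Derivation K A A) :
    DirectSum.of (HochschildCochain K A) i (prodCochain X) *
      DirectSum.of (HochschildCochain K A) j (prodCochain Y) =
    DirectSum.of (HochschildCochain K A) (i + j) (prodCochain (Fin.append X Y)) := by
  rw [DirectSum.of_mul_of, ← prodCochain_cup]
  rfl

/-- An iterated cup product of generators, the last factor being split off. The degree starts at one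
because the generated algebra is not unital. -/
theorem Derivation.prodCochain_mem_MDer {n : ℕ} (X : Fin (n + 1) → Derivation K A A) :
    prodCochain X ∈ MDer K A (n + 1) := by
  change DirectSum.of (HochschildCochain K A) (n + 1) (prodCochain X) ∈ multiderivations K A
  induction n with
  | zero =>
    rw [prodCochain_one]
    exact NonUnitalAlgebra.subset_adjoin K ⟨X 0, rfl⟩
  | succ n ih =>
    have hX : X = Fin.append (fun k : Fin (n + 1) => X (Fin.castAdd 1 k))
        (fun k : Fin 1 => X (Fin.natAdd (n + 1) k)) := Fin.append_castAdd_natAdd.symm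
    rw [hX, ← of_prodCochain_mul]
    refine mul_mem (ih _) ?_
    rw [prodCochain_one]
    exact NonUnitalAlgebra.subset_adjoin K ⟨_, rfl⟩

/-- A function coefficient is absorbed into the first factor, so at least one factor is needed. -/
theorem Derivation.smul_prodCochain {n : ℕ} (g : A) (X : Fin (n + 1) → Derivation K A A) :
    g • prodCochain X = prodCochain (Fin.cons (g • X 0) fun k => X k.succ) := by
  refine PiTensorProduct.ext (MultilinearMap.ext fun a => ?_)
  simp [prodCochain_tprod, Fin.prod_univ_succ, mul_assoc]

/-- Multiderivations are linear combinations of products of derivations. -/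
theorem MDer_le_span (n : ℕ) :
    MDer K A n ≤ Submodule.span K (Set.range (Derivation.prodCochain (K := K) (A := A) (n := n))) := by
  classical
  let S : Submodule K (HochschildAlgebra K A) := Submodule.span K
    {x | ∃ (i : ℕ) (X : Fin i → Derivation K A A),
      x = DirectSum.of (HochschildCochain K A) i (Derivation.prodCochain X)}
  have hS : ∀ x ∈ multiderivations K A, x ∈ S := by
    intro x hx
    induction hx using NonUnitalAlgebra.adjoin_induction with
    | mem x hx =>
      obtain ⟨X, rfl⟩ := hx
      exact Submodule.subset_span ⟨1, fun _ => X, by rw [Derivation.prodCochain_one]⟩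
    | add x y _ _ hx hy => exact add_mem hx hy
    | zero => exact zero_mem _
    | smul c x _ hx => exact Submodule.smul_mem _ c hx
    | mul x y hx' hy' hx hy =>
      clear hx' hy'
      induction hx, hy using Submodule.span_induction₂ with
      | mem_mem x y hx hy =>
        obtain ⟨i, X, rfl⟩ := hx
        obtain ⟨j, Y, rfl⟩ := hy
        exact Submodule.subset_span ⟨_, _, Derivation.of_prodCochain_mul X Y⟩
      | zero_left => rw [zero_mul]; exact zero_mem _
      | zero_right => rw [mul_zero]; exact zero_mem _
      | add_left x y z _ _ _ h1 h2 => rw [add_mul]; exact add_mem h1 h2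
      | add_right x y z _ _ _ h1 h2 => rw [mul_add]; exact add_mem h1 h2
      | smul_left r x y _ _ h => rw [smul_mul_assoc]; exact Submodule.smul_mem _ r h
      | smul_right r x y _ _ h => rw [mul_smul_comm]; exact Submodule.smul_mem _ r h
  -- Projection to degree `n` discards the products of any other length.
  have hcomp : ∀ x ∈ S, x n ∈ Submodule.span K
      (Set.range (Derivation.prodCochain (K := K) (A := A) (n := n))) := by
    intro x hx
    induction hx using Submodule.span_induction with
    | mem x hx =>
      obtain ⟨i, X, rfl⟩ := hx
      by_cases hi : i = n
      · subst hi
        rw [DirectSum.of_eq_same]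
        exact Submodule.subset_span ⟨X, rfl⟩
      · rw [DirectSum.of_eq_of_ne _ _ _ (Ne.symm hi)]
        exact zero_mem _
    | zero => exact zero_mem _
    | add x y _ _ hx hy => exact add_mem hx hy
    | smul c x _ hx => exact Submodule.smul_mem _ c hx
  intro D hD
  have := hcomp _ (hS _ hD)
  rwa [DirectSum.lof_eq_of, DirectSum.of_eq_same] at this

/-- If derivations expand along `h` at an evaluation, then so do multiderivations. -/
theorem MDer.eval_eq_sum {n : ℕ} {B : Type*} [CommRing B] [Algebra K B] (ev : A →ₐ[K] B) {ι : Type*} [Fintype ι]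
    [DecidableEq ι] {h : ι → A} {a : Fin n → A} {c : Fin n → ι → B}
    (hX : ∀ (X : Derivation K A A) k, ev (X (a k)) = ∑ i, c k i * ev (X (h i)))
    {D : HochschildCochain K A n} (hD : D ∈ MDer K A n) :
    ev (D (PiTensorProduct.tprod K a)) =
      ∑ I : Fin n → ι, ev (D (PiTensorProduct.tprod K fun k => h (I k))) * ∏ k, c k (I k) := by
  -- Both sides are linear in `D`, so only products of derivations matter; there a product of sums
  -- is multiplied out.
  replace hD := MDer_le_span n hD
  induction hD using Submodule.span_induction with
  | mem D hD =>
    obtain ⟨X, rfl⟩ := hD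
    simp only [Derivation.prodCochain_tprod, map_prod, hX, ← Finset.prod_mul_distrib]
    rw [Finset.prod_univ_sum]
    simp [mul_comm]
  | zero => simp
  | add D D' _ _ h1 h2 => simp_all [add_mul, Finset.sum_add_distrib]
  | smul r D _ h1 => simp_all [Finset.smul_sum]

end Multiderivations

/-! ### The correspondence between tensor fields and multiderivations. -/

section TensorFieldsAndMultiderivations

variable {m n : ℕ} {M : Type*} [TopologicalSpace M] [ChartedSpace (EuclideanSpace ℝ (Fin m)) M]

/-- Evaluation of smooth functions at `p`. -/
noncomputable def ContMDiffMap.evalₐ (p : M) : C^∞⟮𝓡 m, M; ℝ⟯ →ₐ[ℝ] ℝ where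
  toFun f := f p
  map_one' := rfl
  map_mul' _ _ := rfl
  map_zero' := rfl
  map_add' _ _ := rfl
  commutes' _ := rfl

theorem HochschildCochain.ext_eval {D D' : HochschildCochain ℝ C^∞⟮𝓡 m, M; ℝ⟯ n}
    (h : ∀ (f : Fin n → C^∞⟮𝓡 m, M; ℝ⟯) p, D (⨂ₜ[ℝ] k, f k) p = D' (⨂ₜ[ℝ] k, f k) p) :
    D = D' :=
  PiTensorProduct.ext (MultilinearMap.ext fun f => ContMDiffMap.ext fun p => h f p)

variable [IsManifold (𝓡 m) ∞ M] [T2Space M]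

/-- A multiderivation in the coordinates of a chart. -/
theorem IsCoordGerm.multiderivation_eq_sum
    {φ : OpenPartialHomeomorph M (EuclideanSpace ℝ (Fin m))}
    (hφ : φ ∈ IsManifold.maximalAtlas (𝓡 m) ∞ M) {p : M} {x : Fin m → C^∞⟮𝓡 m, M; ℝ⟯}
    (hx : IsCoordGerm φ p x) (hp : p ∈ φ.source) {D : HochschildCochain ℝ C^∞⟮𝓡 m, M; ℝ⟯ n}
    (hD : D ∈ MDer ℝ C^∞⟮𝓡 m, M; ℝ⟯ n) (f : Fin n → C^∞⟮𝓡 m, M; ℝ⟯) :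
    D (⨂ₜ[ℝ] k, f k) p = ∑ J : Fin n → Fin m, D (⨂ₜ[ℝ] k, x (J k)) p *
      ∏ k, fderiv ℝ (f k ∘ φ.symm) (φ p) (EuclideanSpace.single (J k) 1) :=
  MDer.eval_eq_sum (ContMDiffMap.evalₐ p) (fun X k => X.apply_eq_sum (hx.mvfderiv_eq hφ hp (f k)))
    hD

/-- Both values are expanded along `x`, and the partial derivatives of `x j` and `y j` at `φ p`
agree. -/
theorem IsCoordGerm.multiderivation_eq
    {φ : OpenPartialHomeomorph M (EuclideanSpace ℝ (Fin m))}
    (hφ : φ ∈ IsManifold.maximalAtlas (𝓡 m) ∞ M) {p : M} {x y : Fin m → C^∞⟮𝓡 m, M; ℝ⟯}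
    (hx : IsCoordGerm φ p x) (hy : IsCoordGerm φ p y) (hp : p ∈ φ.source)
    {D : HochschildCochain ℝ C^∞⟮𝓡 m, M; ℝ⟯ n}
    (hD : D ∈ MDer ℝ C^∞⟮𝓡 m, M; ℝ⟯ n) (J : Fin n → Fin m) :
    D (⨂ₜ[ℝ] k, x (J k)) p = D (⨂ₜ[ℝ] k, y (J k)) p := by
  rw [hx.multiderivation_eq_sum hφ hp hD fun k => x (J k),
    hx.multiderivation_eq_sum hφ hp hD fun k => y (J k)]
  simp only [hx.fderiv_apply hp, hy.fderiv_apply hp]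

/-- The components of a tensor are its values on extended coordinate functions. This yields
injectivity of the correspondence. -/
theorem TensorSpace.eq_of_act_eq {p : M} {t s : TensorSpace m n p}
    (h : ∀ f, t.act f = s.act f) : t = s := by
  have hφ := IsManifold.chart_mem_maximalAtlas (I := 𝓡 m) (n := ∞) p
  have hp := mem_chart_source (EuclideanSpace ℝ (Fin m)) p
  obtain ⟨x, hx⟩ := exists_isCoordGerm hφ hp
  rw [hx.sum_act_smul_tprod hφ hp t, hx.sum_act_smul_tprod hφ hp s]
  simp only [h]

/-- Every multiderivation is given by a smooth tensor field. -/
theorem MDer.exists_tensorField {D : HochschildCochain ℝ C^∞⟮𝓡 m, M; ℝ⟯ n}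
    (hD : D ∈ MDer ℝ C^∞⟮𝓡 m, M; ℝ⟯ n) :
    ∃ τ : TensorField m n M, ∀ (f : Fin n → C^∞⟮𝓡 m, M; ℝ⟯) (p : M),
      D (⨂ₜ[ℝ] k, f k) p = (τ p).act f := by
  have hpt (p : M) : ∃ t : TensorSpace m n p, ∀ f : Fin n → C^∞⟮𝓡 m, M; ℝ⟯,
      D (⨂ₜ[ℝ] k, f k) p = t.act f := by
    have hφ := IsManifold.chart_mem_maximalAtlas (I := 𝓡 m) (n := ∞) p
    have hp := mem_chart_source (EuclideanSpace ℝ (Fin m)) p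
    obtain ⟨x, hx⟩ := exists_isCoordGerm hφ hp
    refine ⟨∑ J : Fin n → Fin m, D (⨂ₜ[ℝ] k, x (J k)) p •
      TensorSpace.tprod fun k => coordVector (chartAt _ p) p (J k), fun f => ?_⟩
    rw [hx.multiderivation_eq_sum hφ hp hD, ← TensorSpace.actₗ_apply, map_sum]
    simp only [map_smul, TensorSpace.actₗ_apply, TensorSpace.act_tprod,
      mvfderiv_coordVector hφ hp, smul_eq_mul]
  choose τ hτ using hpt
  refine ⟨⟨τ, (contMDiff_section_iff_act τ).2 fun f => ?_⟩, fun f p => hτ p f⟩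
  -- Smoothness of the section is tested on functions, and `D` takes values in smooth functions.
  rw [← funext fun p => hτ p f]
  exact (D (⨂ₜ[ℝ] k, f k)).contMDiff

/-- Every smooth tensor field of positive degree defines a multiderivation. -/
theorem TensorField.exists_multiderivation [SecondCountableTopology M]
    (τ : TensorField m (n + 1) M) :
    ∃ D : MDer ℝ C^∞⟮𝓡 m, M; ℝ⟯ (n + 1), ∀ (f : Fin (n + 1) → C^∞⟮𝓡 m, M; ℝ⟯) (p : M),
      D.1 (⨂ₜ[ℝ] k, f k) p = (τ p).act f := by
  obtain ⟨h, hh⟩ := exists_separatesTangentOn_univ m M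
  obtain ⟨Y, hY⟩ := hh.exists_derivation
  let g (f : Fin (n + 1) → C^∞⟮𝓡 m, M; ℝ⟯) : C^∞⟮𝓡 m, M; ℝ⟯ :=
    ⟨fun p => (τ p).act f, (contMDiff_section_iff_act τ).1 τ.contMDiff f⟩
  -- Obtained by inserting `df_k = ∑ Y_i(f_k) dh_i` into `τ(f)`: the coefficients are the smooth
  -- functions `τ(h_I)`.
  refine ⟨⟨∑ I : Fin (n + 1) → Fin 3 × Fin (2 * m + 1),
    g (fun k => h (I k)) • Derivation.prodCochain fun k => Y (I k),
    Submodule.sum_mem _ fun I _ => ?_⟩, fun f p => ?_⟩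
  · rw [Derivation.smul_prodCochain]
    exact Derivation.prodCochain_mem_MDer _
  · rw [TensorSpace.act_eq_sum (τ p) h f (fun k i => Y i (f k) p) fun k => hY (f k) p,
      LinearMap.sum_apply, ContMDiffMap.sum_eval]
    refine Finset.sum_congr rfl fun I _ => ?_
    rw [LinearMap.smul_apply, Derivation.prodCochain_tprod]
    refine congrArg ((τ p).act (fun k => h (I k)) * ·) ?_
    exact map_prod (ContMDiffMap.evalₐ p) _ _

/-- The isomorphism between tensor fields and multiderivations. -/
theorem exists_tensorField_equiv_MDer [SecondCountableTopology M] (hn : 1 ≤ n) :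
    ∃ Φ : TensorField m n M ≃ₗ[ℝ] MDer ℝ C^∞⟮𝓡 m, M; ℝ⟯ n,
      ∀ (τ : TensorField m n M) (f : Fin n → C^∞⟮𝓡 m, M; ℝ⟯) (p : M),
        (Φ τ).1 (⨂ₜ[ℝ] k, f k) p = (τ p).act f := by
  obtain ⟨n, rfl⟩ := Nat.exists_eq_add_of_le' hn
  choose Ψ hΨ using TensorField.exists_multiderivation (m := m) (n := n) (M := M)
  let Ψₗ : TensorField m (n + 1) M →ₗ[ℝ] MDer ℝ C^∞⟮𝓡 m, M; ℝ⟯ (n + 1) :=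
    { toFun := Ψ
      map_add' := fun τ σ => Subtype.ext (HochschildCochain.ext_eval fun f p =>
        ((hΨ (τ + σ) f p).trans ((TensorSpace.actₗ p f).map_add (τ p) (σ p))).trans
          (congrArg₂ (· + ·) (hΨ τ f p) (hΨ σ f p)).symm)
      map_smul' := fun c τ => Subtype.ext (HochschildCochain.ext_eval fun f p =>
        ((hΨ (c • τ) f p).trans ((TensorSpace.actₗ p f).map_smul c (τ p))).trans
          (congrArg (c * ·) (hΨ τ f p)).symm) }
  refine ⟨LinearEquiv.ofBijective Ψₗ ⟨fun τ σ h => ?_, fun D => ?_⟩, hΨ⟩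
  · refine ContMDiffSection.ext fun p => TensorSpace.eq_of_act_eq fun f => ?_
    rw [← hΨ, ← hΨ, show Ψ τ = Ψ σ from h]
  · obtain ⟨τ, hτ⟩ := MDer.exists_tensorField D.2
    exact ⟨τ, Subtype.ext (HochschildCochain.ext_eval fun f p => (hΨ τ f p).trans (hτ f p).symm)⟩

end TensorFieldsAndMultiderivations

/-! ### Assembly of the isomorphism and the chart formulas. -/

theorem mainTheorem2 (m n : ℕ) (hn : 1 ≤ n) (M : Type*) [TopologicalSpace M] [T2Space M]
    [SecondCountableTopology M] [ChartedSpace (EuclideanSpace ℝ (Fin m)) M]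
    [IsManifold (𝓡 m) ∞ M] :
    ∃ Φ : TensorField m n M ≃ₗ[ℝ] MDer ℝ C^∞⟮𝓡 m, M; ℝ⟯ n,
      -- `Φ` is the canonical assignment: `Φ(τ)(f₁ ⊗ ⋯ ⊗ fₙ)(p) = τ_p(f₁ ⊗ ⋯ ⊗ fₙ)`
      (∀ (τ : TensorField m n M) (f : Fin n → C^∞⟮𝓡 m, M; ℝ⟯) (p : M),
        (Φ τ).1 (⨂ₜ[ℝ] k, f k) p = (τ p).act f) ∧
      -- the expression of a multiderivation in an arbitrary chart
      ∀ φ ∈ IsManifold.maximalAtlas (𝓡 m) ∞ M, ∀ D : MDer ℝ C^∞⟮𝓡 m, M; ℝ⟯ n,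
        ∃ a : (Fin n → Fin m) → M → ℝ,
          (∀ J, ContMDiffOn (𝓡 m) 𝓘(ℝ, ℝ) ∞ (a J) φ.source) ∧
          ∀ p ∈ φ.source,
            -- `a J p` is `D(x^{J 1} ⊗ ⋯ ⊗ x^{J n})(p)`, computed with any global functions
            -- that agree near `p` with the coordinates of the chart; such functions exist
            (∃ x : Fin m → C^∞⟮𝓡 m, M; ℝ⟯, ∀ j, (x j : M → ℝ) =ᶠ[𝓝 p] fun q => φ q j) ∧
            (∀ x : Fin m → C^∞⟮𝓡 m, M; ℝ⟯,
              (∀ j, (x j : M → ℝ) =ᶠ[𝓝 p] fun q => φ q j) →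
                ∀ J, D.1 (⨂ₜ[ℝ] k, x (J k)) p = a J p) ∧
            (Φ.symm D) p = ∑ J, a J p • TensorSpace.tprod (fun k => coordVector φ p (J k)) ∧
            ∀ f : Fin n → C^∞⟮𝓡 m, M; ℝ⟯,
              D.1 (⨂ₜ[ℝ] k, f k) p =
                ∑ J, a J p * ∏ k, fderiv ℝ (f k ∘ φ.symm) (φ p) (EuclideanSpace.single (J k) 1) := by
  obtain ⟨Φ, hΦ⟩ := exists_tensorField_equiv_MDer (m := m) (M := M) hn
  refine ⟨Φ, hΦ, fun φ hφ D => ?_⟩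
  have hex (q : M) : ∃ x : Fin m → C^∞⟮𝓡 m, M; ℝ⟯, q ∈ φ.source → IsCoordGerm φ q x := by
    by_cases hq : q ∈ φ.source
    · obtain ⟨x, hx⟩ := exists_isCoordGerm hφ hq
      exact ⟨x, fun _ => hx⟩
    · exact ⟨0, fun h => absurd h hq⟩
  choose x hx using hex
  -- The functions `x q` vary with `q` without any regularity; by independence of the choice, the
  -- fixed family `x p` gives the same coefficients near `p`, which are therefore smooth.
  refine ⟨fun J q => D.1 (⨂ₜ[ℝ] k, x q (J k)) q, fun J p hp => ?_, fun p hp =>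
    ⟨⟨x p, hx p hp⟩, fun y hy J => ?_, ?_, fun f => ?_⟩⟩
  · refine ContMDiffAt.contMDiffWithinAt
      ((D.1 (⨂ₜ[ℝ] k, x p (J k))).contMDiff.contMDiffAt.congr_of_eventuallyEq ?_)
    filter_upwards [φ.open_source.mem_nhds hp, (hx p hp).eventually] with q hq hqx
    exact (hx q hq).multiderivation_eq hφ hqx hq D.2 J
  · exact IsCoordGerm.multiderivation_eq hφ hy (hx p hp) hp D.2 J
  · refine ((hx p hp).sum_act_smul_tprod hφ hp _).trans (Finset.sum_congr rfl fun J _ => ?_)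
    rw [← hΦ, LinearEquiv.apply_symm_apply]
  · exact (hx p hp).multiderivation_eq_sum hφ hp D.2 f
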